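/- Let $G$ be a linear complex Lie group, i.e. a closed subgroup of the group $A^\times$ of invertible elements of a finite-dimensional unital complex algebra $A$ (for instance $A=M_n(\mathbb C)$) whose Lie algebra $\mathcal G\subset A$ is a complex subspace. Let $L(G)$ be the group of smooth loops $S^1\to G$, with Lie algebra $\mathcal L=C^\infty(S^1,\mathcal G)$, and let $L_+=L_+(G)\subset L(G)$ be the subgroup of boundary values of holomorphic maps from the unit disc to $G$ (continuous on the closed disc), with Lie algebra $\mathcal L_+=\{\sum_{j\ge 0}A_j\lambda^j\in\mathcal L\}$. Let $L_-\subset L(G)$ be a subgroup, with Lie algebra $\mathcal L_-$ (the velocities at the identity of smooth curves in $L_-$), such that $L_\pm$ is a splitting: $L_+\cap L_-=\{e\}$, and $\mathcal L=\mathcal L_+\oplus\mathcal L_-$ as topological (real) vector spaces for the $C^\infty$ topology. Write $X\mapsto X_-$ for the projection of $\mathcal L$ to $\mathcal L_-$ along $\mathcal L_+$. Let $C$ be a local homomorphism from $S^1$ to $G$: for some $\epsilon>0$ it is a smooth $G$-valued map on $\mathcal I_\epsilon=\{e^{i\theta}: |\theta|<\epsilon\}$ with $C(\lambda_1\lambda_2)=C(\lambda_1)C(\lambda_2)$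 whenever $\lambda_1,\lambda_2,\lambda_1\lambda_2\in\mathcal I_\epsilon$. Here and below $d/d\lambda$ is the derivative along the circle, $\frac{d}{d\lambda}=\frac1{i\lambda}\frac{d}{d\theta}$ for $\lambda=e^{i\theta}$; $f_\lambda=df/d\lambda$ and $C'(1)=\frac{dC}{d\lambda}|_{\lambda=1}$. Let $D_+(S^1)$ be the group of smooth diffeomorphisms of $S^1$ which, with their inverses, are boundary values of holomorphic maps of the disc to itself. For a diffeomorphism $k$ of $S^1$ with $k^{-1}(\lambda)/\lambda\in\mathcal I_\epsilon$ for all $\lambda\in S^1$ (call such $k$ admissible) and $f\in L_-$ put $$(k\diamond f)(\lambda)=f(k^{-1}(\lambda))\,C\!\left(\tfrac{k^{-1}(\lambda)}{\lambda}\right),$$ and let $k\sharp f=g_-$ if $k\diamond f=g_+g_-$ with $g_\pm\in L_\pm$ ($k\sharp f$ is defined when $k$ is admissible and such a factorization exists). Then: 1. **Local action.** For admissible $k\in D_+(S^1)$ and $f\in L_-$, $k\diamond f\in L(G)$ and $k\sharp f$ is unique when it is defined; $\mathrm{id}\,\sharp f=f$; and if $k_1,k_2\in D_+(S^1)$, $k_1$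 and $k_1\circ k_2$ are admissible and $k_2\sharp f$ is defined, then $(k_1\circ k_2)\sharp f$ is defined if and only if $k_1\sharp(k_2\sharp f)$ is, and then they are equal. Moreover, if smooth curves in $L(G)$ through $e$ factor for small parameters into smooth curves in $L_+$ and $L_-$ through $e$, then for every smooth curve $k_s$ of diffeomorphisms of $S^1$ with $k_0=\mathrm{id}$ and every $f\in L_-$, $k_s\sharp f$ is defined for small $|s|$ and is a smooth curve in $L_-$ through $f$. 2. **Infinitesimal action.** Let $k_s$, $|s|<r$, be a smooth curve of diffeomorphisms of $S^1$ (for instance in $D_+(S^1)$) with $k_0=\mathrm{id}$ and velocity $\xi(\lambda)\frac{\partial}{\partial\lambda}$ at $s=0$, and let $f\in L_-$ be such that $k_s\sharp f$ is defined for $|s|<r$ and smooth in $(s,\lambda)$. Then $$\frac{d}{ds}\Big|_{s=0}(k_s\sharp f)=-\left(\xi f_\lambda f^{-1}+\tfrac{\xi}{\lambda} fC'(1)f^{-1}\right)_-f .$$ For $j\ge-1$ the infinitesimal vector field on $L_-$ corresponding to the complex vector field $X_j=\lambda^{j+1}\frac{\partial}{\partial\lambda}$ on $S^1$ is $$Z_j(f)=-\left(\lambda^{j+1}f_\lambda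 f^{-1}+\lambda^jfC'(1)f^{-1}\right)_-f,$$ that is: write $X_j=a+ib$ with real vector fields $a,b$ on $S^1$ and let $k_s,l_s$ be smooth curves of diffeomorphisms through $\mathrm{id}$ with velocities $a,b$. If $k_s\sharp f$ and $l_s\sharp f$ are defined for $|s|<r$ and smooth in $(s,\lambda)$, with velocities $\dot g,\dot h$ at $s=0$, then $Z_j(f)f^{-1}=\dot gf^{-1}+(i\,\dot hf^{-1})_-$ (so $Z_j(f)=\dot g+i\dot h$ if $\mathcal L_-$ is a complex subspace). 3. **Virasoro action.** For all $j\ge-1$ and $f\in L_-$, $\lambda^{j+1}f_\lambda f^{-1}+\lambda^jfC'(1)f^{-1}\in\mathcal L$ and $Z_j(f)f^{-1}\in\mathcal L_-$, so $Z_j$ is a vector field on $L_-$; it has directional derivatives along smooth curves in $L_-$ in the directions of the $Z_k$, and $$[Z_j,Z_k]=(k-j)Z_{j+k},\qquad j,k\ge-1,$$ where $[V,W]=DW(V)-DV(W)$. Thus the $Z_j$ define an action of the positive half Virasoro algebra $\mathcal V_+$ on $L_-$. -/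

import Mathlib

open Set Metric
open scoped Manifold ContDiff

namespace LoopVirasoro

/-! ### Circle diffeomorphisms -/

/-- The group `Diff(S¹)` of smooth diffeomorphisms of the circle. -/
def circleDiffeo : Subgroup (Equiv.Perm Circle) where
  carrier := {k | ContMDiff (𝓡 1) (𝓡 1) ∞ (k : Circle → Circle) ∧
    ContMDiff (𝓡 1) (𝓡 1) ∞ ((k⁻¹ : Equiv.Perm Circle) : Circle → Circle)}
  one_mem' := ⟨contMDiff_id, contMDiff_id⟩
  mul_mem' := by
    rintro a b ⟨ha, ha'⟩ ⟨hb, hb'⟩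
    refine ⟨ha.comp hb, ?_⟩
    rw [mul_inv_rev]
    exact hb'.comp ha'
  inv_mem' := by
    rintro a ⟨ha, ha'⟩
    exact ⟨ha', by rwa [inv_inv]⟩

/-- `k` is the boundary value of a holomorphic map of the disc to itself (continuous up to the
boundary; the circle is then mapped to the circle). -/
def ExtendsToDisc (k : Circle → Circle) : Prop :=
  ∃ F : ℂ → ℂ, DiffContOnCl ℂ F (ball 0 1) ∧ MapsTo F (ball 0 1) (ball 0 1) ∧
    ∀ z : Circle, F z = k z

lemma ExtendsToDisc.comp {a b : Circle → Circle} (ha : ExtendsToDisc a) (hb : ExtendsToDisc b) :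
    ExtendsToDisc (a ∘ b) := by
  obtain ⟨F, hF, hFm, hFe⟩ := ha
  obtain ⟨H, hH, hHm, hHe⟩ := hb
  refine ⟨F ∘ H, hF.comp hH hHm, hFm.comp hHm, fun z => ?_⟩
  simp [hHe, hFe]

/-- The group `D₊(S¹)` of diffeomorphisms of the circle that are (together with their inverses)
boundary values of holomorphic maps of the disc to itself. -/
def DPlus : Subgroup (Equiv.Perm Circle) where
  carrier := {k | k ∈ circleDiffeo ∧ ExtendsToDisc k ∧
    ExtendsToDisc ((k⁻¹ : Equiv.Perm Circle) : Circle → Circle)}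
  one_mem' := by
    have h : ExtendsToDisc ((1 : Equiv.Perm Circle) : Circle → Circle) :=
      ⟨id, differentiable_id.diffContOnCl, mapsTo_id _, fun z => rfl⟩
    exact ⟨one_mem _, h, by simpa using h⟩
  mul_mem' := by
    rintro a b ⟨ha, ha1, ha2⟩ ⟨hb, hb1, hb2⟩
    refine ⟨mul_mem ha hb, ha1.comp hb1, ?_⟩
    rw [mul_inv_rev]
    exact hb2.comp ha2
  inv_mem' := by
    rintro a ⟨ha, ha1, ha2⟩
    exact ⟨inv_mem ha, ha2, by rwa [inv_inv]⟩

/-- `s ↦ k s`, `|s| < r`, is a smooth curve in `Diff(S¹)` that starts at the identity for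
`s = 0`. -/
structure IsDiffeoCurve (r : ℝ) (k : ℝ → Equiv.Perm Circle) : Prop where
  pos : 0 < r
  mem : ∀ s ∈ Ioo (-r) r, k s ∈ circleDiffeo
  smooth : ContMDiffOn (𝓘(ℝ, ℝ).prod (𝓡 1)) (𝓡 1) ∞
    (fun p : ℝ × Circle => k p.1 p.2) (Ioo (-r) r ×ˢ univ)
  smooth_inv : ContMDiffOn (𝓘(ℝ, ℝ).prod (𝓡 1)) (𝓡 1) ∞
    (fun p : ℝ × Circle => (k p.1)⁻¹ p.2) (Ioo (-r) r ×ˢ univ)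
  zero : k 0 = 1

/-- The vector field `ξ(λ) ∂/∂λ` on the circle is the velocity at `s = 0` of the curve `k`. -/
def HasVelocity (k : ℝ → Equiv.Perm Circle) (ξ : Circle → ℂ) : Prop :=
  ∀ z, HasDerivAt (fun s => (k s z : ℂ)) (ξ z) 0

/-! ### Linear complex Lie groups, loop groups and loop algebras -/

variable {A : Type*} [NormedRing A] [NormedAlgebra ℂ A]

/-- The Lie algebra of a group `G` of invertible elements of `A` (for instance of invertible
matrices): the velocities at the identity of the smooth curves in `G`. -/
def lieAlg (G : Subgroup Aˣ) : Set A :=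
  {X | ∃ r > 0, ∃ γ : ℝ → Aˣ, (∀ s ∈ Ioo (-r) r, γ s ∈ G) ∧
    ContDiffOn ℝ ∞ (fun s => (γ s : A)) (Ioo (-r) r) ∧ γ 0 = 1 ∧
    HasDerivAt (fun s => (γ s : A)) X 0}

/-- `G` is a linear complex Lie group: a closed subgroup of the group of invertible elements
whose Lie algebra is a complex subspace. -/
structure IsComplexLieGroup (G : Subgroup Aˣ) : Prop where
  closed : IsClosed (G : Set Aˣ)
  complex : ∀ X ∈ lieAlg G, Complex.I • X ∈ lieAlg G

/-- The derivative `f_λ = df/dλ` along the circle, `λ = e^{iθ}`, i.e. `f_λ = (iλ)⁻¹ df/dθ`. -/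
noncomputable def dLam (f : Circle → A) (z : Circle) : A :=
  (Complex.I * (z : ℂ))⁻¹ • deriv (fun t : ℝ => f (z * Circle.exp t)) 0

section Groups

variable [FiniteDimensional ℂ A]

/-- The group `L(G)` of smooth loops in `G`. -/
def loopGroup (G : Subgroup Aˣ) : Subgroup (Circle → Aˣ) where
  carrier := {f | ContMDiff (𝓡 1) 𝓘(ℝ, A) ∞ (fun z => (f z : A)) ∧ ∀ z, f z ∈ G}
  one_mem' := ⟨contMDiff_const, fun _ => one_mem _⟩
  mul_mem' := by
    rintro a b ⟨ha, ha'⟩ ⟨hb, hb'⟩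
    refine ⟨?_, fun z => mul_mem (ha' z) (hb' z)⟩
    exact (contDiff_mul (𝕜 := ℝ) (𝔸 := A)).comp_contMDiff (ha.prodMk_space hb)
  inv_mem' := by
    rintro a ⟨ha, ha'⟩
    refine ⟨fun z => ?_, fun z => inv_mem (ha' z)⟩
    have : CompleteSpace A := FiniteDimensional.complete ℂ A
    have h : (fun z => ((a⁻¹ z : Aˣ) : A)) = Ring.inverse ∘ fun z => (a z : A) := by
      funext z; simp
    change ContMDiffAt (𝓡 1) 𝓘(ℝ, A) ∞ (fun z => ((a⁻¹ z : Aˣ) : A)) z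
    rw [h]
    exact ContDiffAt.comp_contMDiffAt (f := fun z => (a z : A)) (contDiffAt_ringInverse ℝ (a z)) (ha z)

/-- The group `L₊(G)` of the loops in `G` that are boundary values of a holomorphic map from the
unit disc to `G`. -/
def plusGroup (G : Subgroup Aˣ) : Subgroup (Circle → Aˣ) where
  carrier := {f | f ∈ loopGroup G ∧ ∃ F : ℂ → A, DiffContOnCl ℂ F (ball 0 1) ∧
    (∀ z ∈ closedBall (0 : ℂ) 1, ∃ u ∈ G, (u : A) = F z) ∧ ∀ z : Circle, F z = f z}
  one_mem' := ⟨one_mem _, fun _ => 1, diffContOnCl_const, fun _ _ => ⟨1, one_mem _, rfl⟩,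
    fun _ => rfl⟩
  mul_mem' := by
    rintro a b ⟨ha, F, hF, hFG, hFe⟩ ⟨hb, H, hH, hHG, hHe⟩
    refine ⟨mul_mem ha hb, fun z => F z * H z, ⟨?_, ?_⟩, fun z hz => ?_, fun z => ?_⟩
    · exact hF.differentiableOn.mul hH.differentiableOn
    · exact hF.continuousOn.mul hH.continuousOn
    · obtain ⟨u, hu, hu'⟩ := hFG z hz
      obtain ⟨v, hv, hv'⟩ := hHG z hz
      exact ⟨u * v, mul_mem hu hv, by simp [hu', hv']⟩
    · simp [hFe, hHe]
  inv_mem' := by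
    rintro a ⟨ha, F, hF, hFG, hFe⟩
    have : CompleteSpace A := FiniteDimensional.complete ℂ A
    refine ⟨inv_mem ha, fun z => Ring.inverse (F z), ⟨fun z hz => ?_, fun z hz => ?_⟩,
      fun z hz => ?_, fun z => ?_⟩
    · obtain ⟨u, -, hu⟩ := hFG z (ball_subset_closedBall hz)
      have h := differentiableAt_inverse (𝕜 := ℂ) (R := A) (x := F z) (hu ▸ u.isUnit)
      exact h.comp_differentiableWithinAt z (hF.differentiableOn z hz)
    · obtain ⟨u, -, hu⟩ := hFG z (closure_ball_subset_closedBall hz)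
      have h : ContinuousAt Ring.inverse (F z) := hu ▸ NormedRing.inverse_continuousAt u
      exact h.comp_continuousWithinAt (hF.continuousOn z hz)
    · obtain ⟨u, hu, hu'⟩ := hFG z hz
      exact ⟨u⁻¹, inv_mem hu, by simp [← hu']⟩
    · simp [hFe]

end Groups

/-- The Lie algebra `𝓛` of `L(G)`: the smooth loops in the Lie algebra of `G`. -/
def loopAlg (G : Subgroup Aˣ) : Set (Circle → A) :=
  {X | ContMDiff (𝓡 1) 𝓘(ℝ, A) ∞ X ∧ ∀ z, X z ∈ lieAlg G}

/-- The Lie algebra `𝓛₊` of `L₊(G)`: the loops `∑_{j ≥ 0} A_j λ^j` in the Lie algebra of `G`. -/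
def plusAlg (G : Subgroup Aˣ) : Set (Circle → A) :=
  {X | X ∈ loopAlg G ∧ ∃ F : ℂ → A, DiffContOnCl ℂ F (ball 0 1) ∧ ∀ z : Circle, F z = X z}

/-- `s ↦ γ s`, `|s| < r`, is a smooth curve of loops (it is jointly smooth in `s` and `λ`). -/
def SmoothCurve (r : ℝ) (γ : ℝ → Circle → Aˣ) : Prop :=
  ContMDiffOn (𝓘(ℝ, ℝ).prod (𝓡 1)) 𝓘(ℝ, A) ∞
    (fun p : ℝ × Circle => (γ p.1 p.2 : A)) (Ioo (-r) r ×ˢ univ)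

/-- `s ↦ γ s`, `|s| < r`, is a smooth curve in the group `H` of loops that passes through `f` at
`s = 0`. -/
structure IsCurveIn (H : Subgroup (Circle → Aˣ)) (r : ℝ) (γ : ℝ → Circle → Aˣ)
    (f : Circle → Aˣ) : Prop where
  pos : 0 < r
  mem : ∀ s ∈ Ioo (-r) r, γ s ∈ H
  smooth : SmoothCurve r γ
  zero : γ 0 = f

/-- The loop `X` is the velocity of the curve `γ` of loops at `s = 0`. -/
def HasLoopVelocity (γ : ℝ → Circle → Aˣ) (X : Circle → A) : Prop :=
  ∀ z, HasDerivAt (fun s => (γ s z : A)) (X z) 0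

/-- The Lie algebra of a group `H` of loops: the velocities at the identity of the smooth curves
in `H`. -/
def loopLieAlg (H : Subgroup (Circle → Aˣ)) : Set (Circle → A) :=
  {X | ∃ r γ, IsCurveIn H r γ 1 ∧ HasLoopVelocity γ X}

/-- `Y` is the component in `𝓛₋` of `X`, with respect to `𝓛 = 𝓛₊ + 𝓛₋`. -/
def IsMinusPart (G : Subgroup Aˣ) (Lm : Subgroup (Circle → Aˣ)) (X Y : Circle → A) : Prop :=
  Y ∈ loopLieAlg Lm ∧ X - Y ∈ plusAlg G

/-- `X ↦ X₋`, the projection of `𝓛` to `𝓛₋` along `𝓛₊`. -/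
noncomputable def minusPart (G : Subgroup Aˣ) (Lm : Subgroup (Circle → Aˣ)) (X : Circle → A) :
    Circle → A :=
  Classical.epsilon (IsMinusPart G Lm X)

section Splitting

variable [FiniteDimensional ℂ A]

/-- `L₊ = L₊(G)` and `L₋` form a splitting of `L(G)`: they are subgroups with trivial
intersection, and `𝓛` is the topological direct sum of their Lie algebras, for the topology of
uniform convergence of all derivatives. -/
structure IsSplitting (G : Subgroup Aˣ) (Lm : Subgroup (Circle → Aˣ)) : Prop where
  le : Lm ≤ loopGroup G
  inf_eq : plusGroup G ⊓ Lm = ⊥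
  alg_inter : plusAlg G ∩ loopLieAlg Lm = {0}
  alg_add : ∀ X ∈ loopAlg G, ∃ Y, IsMinusPart G Lm X Y
  continuous_proj : ∀ N : ℕ, ∃ (M : ℕ) (K : ℝ), ∀ X ∈ loopAlg G, ∀ Y, IsMinusPart G Lm X Y →
    ∀ B : ℝ, (∀ i ≤ M, ∀ t : ℝ, ‖iteratedDeriv i (fun u : ℝ => X (Circle.exp u)) t‖ ≤ B) →
      ∀ i ≤ N, ∀ t : ℝ, ‖iteratedDeriv i (fun u : ℝ => Y (Circle.exp u)) t‖ ≤ K * B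

/-- Smooth curves in `L(G)` through the identity factor, for small parameters, as `g₊ g₋` with
smooth curves `g₊` in `L₊(G)` and `g₋` in `L₋`. -/
def FactorsLocally (G : Subgroup Aˣ) (Lm : Subgroup (Circle → Aˣ)) : Prop :=
  ∀ r γ, IsCurveIn (loopGroup G) r γ 1 → ∃ r' gp gm,
    IsCurveIn (plusGroup G) r' gp 1 ∧ IsCurveIn Lm r' gm 1 ∧
    ∀ s ∈ Ioo (-r') r', γ s = gp s * gm s

end Splitting

/-! ### Local homomorphisms and the action -/

/-- The arc `{e^{iθ} | |θ| < ε}`. -/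
def arc (ε : ℝ) : Set Circle := {z | ∃ t : ℝ, |t| < ε ∧ z = Circle.exp t}

/-- `C`, restricted to the arc of size `ε`, is a local homomorphism (of Lie groups) from `S¹` to
`G`. -/
structure IsLocalHom (G : Subgroup Aˣ) (ε : ℝ) (C : Circle → Aˣ) : Prop where
  pos : 0 < ε
  mem : ∀ z ∈ arc ε, C z ∈ G
  smooth : ContMDiffOn (𝓡 1) 𝓘(ℝ, A) ∞ (fun z => (C z : A)) (arc ε)
  mul : ∀ z ∈ arc ε, ∀ w ∈ arc ε, z * w ∈ arc ε → C (z * w) = C z * C w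

/-- `C'(1) = dC/dλ` at `λ = 1`. -/
noncomputable def derivOne (C : Circle → Aˣ) : A := dLam (fun z => (C z : A)) 1

/-- `C(k⁻¹(λ)/λ)` is defined for all `λ`. -/
def InDomain (ε : ℝ) (k : Equiv.Perm Circle) : Prop := ∀ z, k⁻¹ z / z ∈ arc ε

/-- `(k ⋄ f)(λ) = f(k⁻¹(λ)) C(k⁻¹(λ)/λ)`. -/
noncomputable def diamond (C : Circle → Aˣ) (k : Equiv.Perm Circle) (f : Circle → Aˣ) : Circle → Aˣ :=
  fun z => f (k⁻¹ z) * C (k⁻¹ z / z)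

/-- `k ♯ f` is defined and equal to `g`: `k ⋄ f` is defined and `k ⋄ f = g₊ g` with `g₊` in
`L₊(G)` and `g` in `L₋`. -/
def IsSharp [FiniteDimensional ℂ A] (G : Subgroup Aˣ) (Lm : Subgroup (Circle → Aˣ)) (ε : ℝ)
    (C : Circle → Aˣ) (k : Equiv.Perm Circle) (f g : Circle → Aˣ) : Prop :=
  InDomain ε k ∧ g ∈ Lm ∧ ∃ gp ∈ plusGroup G, diamond C k f = gp * g

/-- The loop `ξ f_λ f⁻¹ + (ξ/λ) f C'(1) f⁻¹`. -/
noncomputable def symbol (C : Circle → Aˣ) (ξ : Circle → ℂ) (f : Circle → Aˣ) : Circle → A :=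
  fun z => ξ z • (dLam (fun w => (f w : A)) z * ((f z)⁻¹ : Aˣ)) +
    (ξ z / (z : ℂ)) • ((f z : A) * derivOne C * ((f z)⁻¹ : Aˣ))

/-- The loop `λ^{j+1} f_λ f⁻¹ + λ^j f C'(1) f⁻¹`. -/
noncomputable def virasoroSymbol (C : Circle → Aˣ) (j : ℤ) (f : Circle → Aˣ) : Circle → A :=
  fun z => (z : ℂ) ^ (j + 1) • (dLam (fun w => (f w : A)) z * ((f z)⁻¹ : Aˣ)) +
    (z : ℂ) ^ j • ((f z : A) * derivOne C * ((f z)⁻¹ : Aˣ))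

/-- The vector field `Z_j(f) = -(λ^{j+1} f_λ f⁻¹ + λ^j f C'(1) f⁻¹)₋ f` on `L₋`. -/
noncomputable def virasoroField (G : Subgroup Aˣ) (Lm : Subgroup (Circle → Aˣ))
    (C : Circle → Aˣ) (j : ℤ) (f : Circle → Aˣ) : Circle → A :=
  fun z => -(minusPart G Lm (virasoroSymbol C j f) z) * (f z : A)

/-- `V` is tangent to `H`: `V(f) f⁻¹` lies in the Lie algebra of `H`. -/
def IsTangentField (H : Subgroup (Circle → Aˣ)) (V : (Circle → Aˣ) → Circle → A) : Prop :=
  ∀ f ∈ H, (fun z => V f z * ((f z)⁻¹ : Aˣ)) ∈ loopLieAlg H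

/-- `U` is the Lie bracket `[V, W] = DW(V) - DV(W)` of vector fields on `H`; the directional
derivatives are taken along arbitrary smooth curves in `H`, and exist. -/
def IsLieBracket (H : Subgroup (Circle → Aˣ)) (V W U : (Circle → Aˣ) → Circle → A) : Prop :=
  ∀ f ∈ H, ∀ r γ δ, IsCurveIn H r γ f → HasLoopVelocity γ (V f) →
    IsCurveIn H r δ f → HasLoopVelocity δ (W f) →
    ∀ z, ∃ a b : A, HasDerivAt (fun s => W (γ s) z) a 0 ∧ HasDerivAt (fun s => V (δ s) z) b 0 ∧
      U f z = a - b

end LoopVirasoro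

/-!
The formulas rest on two facts about `γ_s = (k_s ⋄ f) f⁻¹`, a smooth curve of loops in `G` through
the identity. Writing `k_s⁻¹(λ) = λ e^{iτ(s)}`, differentiation of `k_s(λ e^{iτ(s)}) = λ` gives
`τ'(0) = -ξ/(iλ)`, so the velocity of `γ` is minus the symbol `ξ f_λ f⁻¹ + (ξ/λ) f C'(1) f⁻¹`
(`hasLoopVelocity_diamond`). And if `k_s ⋄ f = g₊ g_s`, then `g₊ = γ_s f g_s⁻¹` is a smooth curve in
`L₊`, whose velocity extends to the disc by the maximum principle; hence the velocity of `g_s f⁻¹`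
is the `𝓛₋`-component of that of `γ` (`isMinusPart_symbol`). The action property is the cocycle
identity `diamond_mul` together with the invariance of `L₊` under `D₊(S¹)`.

For the bracket let `X = S_j(f)`, `Y = S_k(f)` be the symbols of `Z_j`, `Z_k`, with `𝓛₋`-components
`P`, `Q`. Along a curve with velocity `Z_j(f) = -P f` the symbol `S_k` varies by
`-λ^{k+1} P_λ - [P, Y]` (`loopDeriv_virasoroSymbol`), and the projection to `𝓛₋`, being continuous,
commutes with the derivative (`hasDerivAt_minusPart`). So `[Z_j, Z_k](f) f⁻¹` is the
`𝓛₋`-component of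
`λ^{k+1} P_λ - λ^{j+1} Q_λ + [P, Y] - [Q, X] - [P, Q]`, where `[P, Q] ∈ 𝓛₋` because `𝓛₋` is closed.
Modulo `𝓛₊`, which is closed under brackets and under `λ^n d/dλ` for `n ≥ 0`, this loop equals
`λ^{k+1} X_λ - λ^{j+1} Y_λ + [X, Y]`. Since `S_j = λ^{j+1} S_{-1}`, the symbols commute and the rest
is `(j - k) S_{j+k}(f)`.

Smoothness on the circle is expressed through the angle, by `contMDiff_circle_iff` and
`contMDiffOn_cylinder_iff`; all analysis then takes place on strips `(-r, r) × ℝ`.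
-/

namespace LoopVirasoro

/-! ### Smooth functions on the circle and on cylinders -/

section CircleCalculus

variable {E : Type*} [NormedAddCommGroup E] [NormedSpace ℝ E]

/-- The local inverse `z ↦ t₀ + arg (z / e^{it₀})` of `Circle.exp` at `e^{it₀}`. -/
noncomputable def circleLog (t₀ : ℝ) (z : Circle) : ℝ := t₀ + ((z / Circle.exp t₀ : Circle) : ℂ).arg

lemma exp_circleLog (t₀ : ℝ) (z : Circle) : Circle.exp (circleLog t₀ z) = z := by
  rw [circleLog, Circle.exp_add, Circle.exp_arg, mul_div_cancel]

lemma contMDiff_circle_coe : ContMDiff (𝓡 1) 𝓘(ℝ, ℂ) ∞ (fun z : Circle => (z : ℂ)) := by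
  have := finrank_real_complex_fact'
  exact contMDiff_coe_sphere

lemma contMDiffAt_arg_one :
    ContMDiffAt (𝓡 1) 𝓘(ℝ, ℝ) ∞ (fun z : Circle => (z : ℂ).arg) 1 := by
  have h : ContDiffAt ℝ ∞ (fun w : ℂ => (Complex.log w).im) ((1 : Circle) : ℂ) := by
    have h1 : ContDiffAt ℝ ∞ Complex.log ((1 : Circle) : ℂ) :=
      (Complex.contDiffAt_log (by simp)).restrict_scalars ℝ
    exact Complex.imCLM.contDiff.contDiffAt.comp _ h1
  have := h.comp_contMDiffAt (f := fun z : Circle => (z : ℂ)) (contMDiff_circle_coe 1)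
  simpa [Function.comp_def, Complex.log_im] using this

lemma contMDiffAt_circleLog (t₀ : ℝ) :
    ContMDiffAt (𝓡 1) 𝓘(ℝ, ℝ) ∞ (circleLog t₀) (Circle.exp t₀) := by
  have h1 : ContMDiffAt (𝓡 1) (𝓡 1) ∞ (fun z : Circle => z / Circle.exp t₀) (Circle.exp t₀) :=
    (contMDiff_id.div contMDiff_const).contMDiffAt
  have h2 : ContMDiffAt (𝓡 1) 𝓘(ℝ, ℝ) ∞
      (fun z : Circle => ((z / Circle.exp t₀ : Circle) : ℂ).arg) (Circle.exp t₀) := by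
    have : ContMDiffAt (𝓡 1) 𝓘(ℝ, ℝ) ∞ (fun z : Circle => (z : ℂ).arg)
      (Circle.exp t₀ / Circle.exp t₀) := by rw [div_self']; exact contMDiffAt_arg_one
    exact ContMDiffAt.comp (g := fun z : Circle => (z : ℂ).arg) (Circle.exp t₀) this h1
  have h3 : ContDiff ℝ ∞ (fun x : ℝ => t₀ + x) := by fun_prop
  exact h3.contDiffAt.comp_contMDiffAt h2

/-- A function on the circle is smooth iff it is a smooth function of the angle. -/
theorem contMDiff_circle_iff {f : Circle → E} :
    ContMDiff (𝓡 1) 𝓘(ℝ, E) ∞ f ↔ ContDiff ℝ ∞ (fun t : ℝ => f (Circle.exp t)) := by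
  refine ⟨fun h => (h.comp contMDiff_circleExp).contDiff, fun h z => ?_⟩
  obtain ⟨t₀, rfl⟩ := Circle.exp_surjective z
  have := h.contDiffAt.comp_contMDiffAt (x := Circle.exp t₀) (contMDiffAt_circleLog t₀)
  simpa [Function.comp_def, exp_circleLog] using this

/-- The strip `(-r, r) × ℝ`. -/
def strip (r : ℝ) : Set (ℝ × ℝ) := Ioo (-r) r ×ˢ univ

lemma isOpen_strip (r : ℝ) : IsOpen (strip r) := isOpen_Ioo.prod isOpen_univ

lemma mem_strip {r : ℝ} {p : ℝ × ℝ} : p ∈ strip r ↔ p.1 ∈ Ioo (-r) r := by simp [strip]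

/-- A function on the cylinder `(-r, r) × S¹` is smooth iff it is smooth in the parameter and
the angle. -/
theorem contMDiffOn_cylinder_iff {r : ℝ} {F : ℝ × Circle → E} :
    ContMDiffOn (𝓘(ℝ, ℝ).prod (𝓡 1)) 𝓘(ℝ, E) ∞ F (Ioo (-r) r ×ˢ univ) ↔
      ContDiffOn ℝ ∞ (fun p : ℝ × ℝ => F (p.1, Circle.exp p.2)) (strip r) := by
  constructor
  · intro h
    have h1 : ContMDiff 𝓘(ℝ, ℝ × ℝ) (𝓘(ℝ, ℝ).prod (𝓡 1)) ∞
        (fun p : ℝ × ℝ => (p.1, Circle.exp p.2)) :=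
      contDiff_fst.contMDiff.prodMk (contMDiff_circleExp.comp contDiff_snd.contMDiff)
    exact (h.comp h1.contMDiffOn (fun p hp => by simpa [strip] using hp)).contDiffOn
  · rintro h ⟨s, z⟩ hp
    have hs : s ∈ Ioo (-r) r := hp.1
    obtain ⟨t₀, rfl⟩ := Circle.exp_surjective z
    have h1 : ContDiffAt ℝ ∞ (fun p : ℝ × ℝ => F (p.1, Circle.exp p.2)) (s, t₀) :=
      h.contDiffAt ((isOpen_strip r).mem_nhds (mem_strip.2 hs))
    have h2 : ContMDiffAt (𝓘(ℝ, ℝ).prod (𝓡 1)) 𝓘(ℝ, ℝ × ℝ) ∞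
        (fun p : ℝ × Circle => (p.1, circleLog t₀ p.2)) (s, Circle.exp t₀) :=
      contMDiffAt_fst.prodMk_space
        (ContMDiffAt.comp (g := circleLog t₀) (s, Circle.exp t₀) (contMDiffAt_circleLog t₀)
          contMDiffAt_snd)
    have h3 : ContDiffAt ℝ ∞ (fun p : ℝ × ℝ => F (p.1, Circle.exp p.2))
        ((fun p : ℝ × Circle => (p.1, circleLog t₀ p.2)) (s, Circle.exp t₀)) := by
      simpa [circleLog] using h1
    have := ContDiffAt.comp_contMDiffAt
      (f := fun p : ℝ × Circle => (p.1, circleLog t₀ p.2)) h3 h2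
    simp only [Function.comp_def, exp_circleLog] at this
    exact this.contMDiffWithinAt

/-- The partial derivative of a function of `(s, t)` in `s`. -/
noncomputable def pS (φ : ℝ × ℝ → E) (p : ℝ × ℝ) : E := fderiv ℝ φ p (1, 0)

/-- The partial derivative of a function of `(s, t)` in `t`. -/
noncomputable def pT (φ : ℝ × ℝ → E) (p : ℝ × ℝ) : E := fderiv ℝ φ p (0, 1)

variable {r : ℝ} {φ ψ : ℝ × ℝ → E}

lemma ContDiffOn.fderiv_apply_strip (h : ContDiffOn ℝ ∞ φ (strip r)) (v : ℝ × ℝ) :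
    ContDiffOn ℝ ∞ (fun p => fderiv ℝ φ p v) (strip r) :=
  (h.fderiv_of_isOpen (isOpen_strip r) (m := ∞) (by simp)).clm_apply contDiffOn_const

lemma contDiffOn_pS (h : ContDiffOn ℝ ∞ φ (strip r)) : ContDiffOn ℝ ∞ (pS φ) (strip r) :=
  ContDiffOn.fderiv_apply_strip h _

lemma contDiffOn_pT (h : ContDiffOn ℝ ∞ φ (strip r)) : ContDiffOn ℝ ∞ (pT φ) (strip r) :=
  ContDiffOn.fderiv_apply_strip h _

lemma contDiffAt_of_strip (h : ContDiffOn ℝ ∞ φ (strip r)) {s : ℝ} (hs : s ∈ Ioo (-r) r) (t : ℝ) :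
    ContDiffAt ℝ ∞ φ (s, t) :=
  h.contDiffAt ((isOpen_strip r).mem_nhds (mem_strip.2 hs))

lemma hasDerivAt_pS (h : ContDiffOn ℝ ∞ φ (strip r)) {s : ℝ} (hs : s ∈ Ioo (-r) r) (t : ℝ) :
    HasDerivAt (fun s => φ (s, t)) (pS φ (s, t)) s := by
  have h1 := ((contDiffAt_of_strip h hs t).differentiableAt (by simp)).hasFDerivAt
  have h2 : HasDerivAt (fun s : ℝ => (s, t)) ((1 : ℝ), (0 : ℝ)) s :=
    (hasDerivAt_id s).prodMk (hasDerivAt_const s t)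
  exact h1.comp_hasDerivAt s h2

lemma hasDerivAt_pT (h : ContDiffOn ℝ ∞ φ (strip r)) {s : ℝ} (hs : s ∈ Ioo (-r) r) (t : ℝ) :
    HasDerivAt (fun t => φ (s, t)) (pT φ (s, t)) t := by
  have h1 := ((contDiffAt_of_strip h hs t).differentiableAt (by simp)).hasFDerivAt
  have h2 : HasDerivAt (fun t : ℝ => (s, t)) ((0 : ℝ), (1 : ℝ)) t :=
    (hasDerivAt_const t s).prodMk (hasDerivAt_id t)
  exact h1.comp_hasDerivAt t h2

lemma pS_pT_comm (h : ContDiffOn ℝ ∞ φ (strip r)) {s : ℝ} (hs : s ∈ Ioo (-r) r) (t : ℝ) :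
    pS (pT φ) (s, t) = pT (pS φ) (s, t) := by
  have h0 := contDiffAt_of_strip h hs t
  have h1 : DifferentiableAt ℝ (fderiv ℝ φ) (s, t) :=
    (h0.fderiv_right (m := ∞) (by simp)).differentiableAt (by simp)
  have h2 := h0.isSymmSndFDerivAt
    (by simpa using WithTop.coe_le_coe.2 (le_top : (2 : ℕ∞) ≤ ⊤)) (1, 0) (0, 1)
  have e : ∀ v w : ℝ × ℝ, fderiv ℝ (fun p => fderiv ℝ φ p v) (s, t) w =
      fderiv ℝ (fderiv ℝ φ) (s, t) w v := fun v w => by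
    rw [fderiv_clm_apply h1 (differentiableAt_const v)]
    simp
  unfold pS pT
  rw [e, e]
  exact h2

lemma pT_congr (h : ∀ p ∈ strip r, φ p = ψ p) {p : ℝ × ℝ} (hp : p ∈ strip r) : pT φ p = pT ψ p := by
  have : φ =ᶠ[nhds p] ψ := Filter.eventually_of_mem ((isOpen_strip r).mem_nhds hp) h
  rw [pT, pT, this.fderiv_eq]

lemma contDiffOn_iterate_pT (h : ContDiffOn ℝ ∞ φ (strip r)) (i : ℕ) :
    ContDiffOn ℝ ∞ (pT^[i] φ) (strip r) := by
  induction i with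
  | zero => simpa
  | succ i ih => rw [Function.iterate_succ_apply']; exact contDiffOn_pT ih

lemma pS_iterate_pT_comm (h : ContDiffOn ℝ ∞ φ (strip r)) (i : ℕ) :
    ∀ p ∈ strip r, pS (pT^[i] φ) p = pT^[i] (pS φ) p := by
  induction i with
  | zero => simp
  | succ i ih =>
    intro p hp
    rw [Function.iterate_succ_apply', Function.iterate_succ_apply',
      pS_pT_comm (contDiffOn_iterate_pT h i) (mem_strip.1 hp), pT_congr ih hp]

lemma iteratedDeriv_eq_iterate_pT (h : ContDiffOn ℝ ∞ φ (strip r)) {s : ℝ} (hs : s ∈ Ioo (-r) r)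
    (i : ℕ) (t : ℝ) : iteratedDeriv i (fun u => φ (s, u)) t = pT^[i] φ (s, t) := by
  induction i generalizing t with
  | zero => simp
  | succ i ih =>
    rw [iteratedDeriv_succ, Function.iterate_succ_apply', funext ih]
    exact (hasDerivAt_pT (contDiffOn_iterate_pT h i) hs t).deriv

/-- A smooth function of `(s, t)`, periodic in `t`, that vanishes to first order at `s = 0` is
`o(s)` uniformly in `t`. -/
lemma uniform_littleO (hr : 0 < r) (h : ContDiffOn ℝ ∞ φ (strip r)) {T : ℝ} (hT : 0 < T)
    (hper : ∀ s, Function.Periodic (fun t => φ (s, t)) T) (h0 : ∀ t, φ (0, t) = 0)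
    (h1 : ∀ t, pS φ (0, t) = 0) {c : ℝ} (hc : 0 < c) :
    ∃ δ > 0, δ ≤ r ∧ ∀ s ∈ Ioo (-δ) δ, ∀ t, ‖φ (s, t)‖ ≤ c * |s| := by
  have hs0 : (0 : ℝ) ∈ Ioo (-r) r := ⟨by linarith, hr⟩
  -- by compactness of a period, `pS φ` is small on a neighbourhood of the whole line `s = 0`
  have hev : ∀ᶠ s in nhds (0 : ℝ), ∀ t ∈ Icc (0 : ℝ) T, ‖pS φ (s, t)‖ < c := by
    apply isCompact_Icc.eventually_forall_of_forall_eventually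
    intro t _
    have hcont : ContinuousAt (pS φ) (0, t) :=
      (contDiffAt_of_strip (contDiffOn_pS h) hs0 t).continuousAt
    have : ∀ᶠ p in nhds ((0 : ℝ), t), ‖pS φ p‖ < c :=
      hcont.norm.eventually_lt continuousAt_const (by simpa [h1] using hc)
    exact this
  obtain ⟨δ, hδ, hball⟩ := Metric.eventually_nhds_iff.1 hev
  refine ⟨min δ r, lt_min hδ hr, min_le_right _ _, fun s hs t => ?_⟩
  obtain ⟨t', ht', e⟩ := (hper s).exists_mem_Ico₀ hT t
  rw [e]
  have hs' : |s| < min δ r := abs_lt.2 hs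
  have key := (convex_Ioo (-(min δ r)) (min δ r)).norm_image_sub_le_of_norm_hasDerivWithin_le
    (f := fun s => φ (s, t')) (f' := fun s => pS φ (s, t')) (C := c) (x := 0) (y := s)
    (fun x hx => (hasDerivAt_pS h ⟨by linarith [hx.1, min_le_right δ r],
      by linarith [hx.2, min_le_right δ r]⟩ t').hasDerivWithinAt)
    (fun x hx => (hball (by
      rw [Real.dist_eq, sub_zero]
      exact (abs_lt.2 hx).trans_le (min_le_left _ _)) t' ⟨ht'.1, ht'.2.le⟩).le)
    ⟨by linarith [lt_min hδ hr], lt_min hδ hr⟩ hs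
  simpa [h0] using key

/-- `uniform_littleO` for all derivatives in `t` up to order `N`. -/
lemma uniform_littleO_iteratedDeriv (hr : 0 < r) (h : ContDiffOn ℝ ∞ φ (strip r)) {T : ℝ}
    (hT : 0 < T) (hper : ∀ s, Function.Periodic (fun t => φ (s, t)) T) (h0 : ∀ t, φ (0, t) = 0)
    (h1 : ∀ t, pS φ (0, t) = 0) {c : ℝ} (hc : 0 < c) (N : ℕ) :
    ∃ δ > 0, δ ≤ r ∧ ∀ s ∈ Ioo (-δ) δ, ∀ i ≤ N, ∀ t,
      ‖iteratedDeriv i (fun u => φ (s, u)) t‖ ≤ c * |s| := by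
  have hs0 : (0 : ℝ) ∈ Ioo (-r) r := ⟨by linarith, hr⟩
  have pTper : ∀ ψ : ℝ × ℝ → E, (∀ s, Function.Periodic (fun t => ψ (s, t)) T) →
      ∀ s, Function.Periodic (fun t => pT ψ (s, t)) T := by
    intro ψ hψ s t
    have e : ψ = fun p => ψ (p + (0, T)) := by
      funext p
      have := hψ p.1 p.2
      simp only at this
      rw [← this]; simp [Prod.add_def]
    simp only [pT]
    conv_rhs => rw [e]
    rw [fderiv_comp_add_right]
    simp
  have iper : ∀ i : ℕ, ∀ s, Function.Periodic (fun t => (pT^[i] φ) (s, t)) T := by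
    intro i
    induction i with
    | zero => simpa
    | succ i ih => intro s; rw [Function.iterate_succ_apply']; exact pTper _ ih s
  have vanish : ∀ χ : ℝ × ℝ → E, ContDiffOn ℝ ∞ χ (strip r) → (∀ t, χ (0, t) = 0) →
      ∀ i t, (pT^[i] χ) (0, t) = 0 := by
    intro χ hχ hχ0 i t
    rw [← iteratedDeriv_eq_iterate_pT hχ hs0, funext hχ0]
    simp
  have hi : ∀ i, ∃ δ > 0, δ ≤ r ∧ ∀ s ∈ Ioo (-δ) δ, ∀ t, ‖(pT^[i] φ) (s, t)‖ ≤ c * |s| :=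
    fun i => uniform_littleO hr (contDiffOn_iterate_pT h i) hT (iper i) (vanish φ h h0 i)
      (fun t => by
        rw [pS_iterate_pT_comm h i _ (mem_strip.2 hs0)]
        exact vanish _ (contDiffOn_pS h) h1 i t) hc
  induction N with
  | zero =>
    obtain ⟨δ, hδ, hδr, H⟩ := hi 0
    refine ⟨δ, hδ, hδr, fun s hs i hiN t => ?_⟩
    obtain rfl : i = 0 := by omega
    simpa using H s hs t
  | succ N ih =>
    obtain ⟨δ, hδ, hδr, H⟩ := hi (N + 1)
    obtain ⟨δ', hδ', hδr', H'⟩ := ih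
    refine ⟨min δ δ', lt_min hδ hδ', (min_le_left _ _).trans hδr, fun s hs i hiN t => ?_⟩
    have hs1 : |s| < min δ δ' := abs_lt.2 hs
    rcases Nat.lt_or_ge N i with hlt | hle
    · obtain rfl : i = N + 1 := by omega
      have hsδ := abs_lt.1 (hs1.trans_le (min_le_left _ _))
      rw [iteratedDeriv_eq_iterate_pT h (abs_lt.1 ((hs1.trans_le (min_le_left _ _)).trans_le hδr))]
      exact H s hsδ t
    · exact H' s (abs_lt.1 (hs1.trans_le (min_le_right _ _))) i hle t

end CircleCalculus

/-! ### The Lie algebra of a linear complex Lie group -/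

section LieAlgebra

variable {A : Type*} [NormedRing A] [NormedAlgebra ℂ A]

/-- The product rule, for the real structure underlying the complex algebra `A`. -/
lemma hasDerivAt_mul_fun {u v : ℝ → A} {u' v' : A} {s : ℝ} (hu : HasDerivAt u u' s)
    (hv : HasDerivAt v v' s) : HasDerivAt (fun x => u x * v x) (u' * v s + u s * v') s :=
  HasDerivAt.mul hu hv

/-- A derivative of a curve in a closed real subspace lies in that subspace. -/
lemma HasDerivAt.mem_of_isClosed {E : Type*} [NormedAddCommGroup E] [NormedSpace ℝ E]
    {p : Submodule ℝ E} (hp : IsClosed (p : Set E)) {φ : ℝ → E} {φ' : E} {s : ℝ}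
    (h : HasDerivAt φ φ' s) (hφ : ∀ᶠ x in nhds s, φ x ∈ p) : φ' ∈ p := by
  refine hp.mem_of_tendsto (hasDerivAt_iff_tendsto_slope.1 h) ?_
  have hs : φ s ∈ p := hφ.self_of_nhds
  filter_upwards [hφ.filter_mono nhdsWithin_le_nhds] with x hx
  rw [slope_def_module]
  exact p.smul_mem _ (p.sub_mem hx hs)

lemma Ioo_subset_of_le {r r' : ℝ} (h : r' ≤ r) : Ioo (-r') r' ⊆ Ioo (-r) r :=
  Ioo_subset_Ioo (by linarith) h

lemma zero_mem_Ioo {r : ℝ} (hr : 0 < r) : (0 : ℝ) ∈ Ioo (-r) r := ⟨by linarith, hr⟩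

lemma Ioo_mem_nhds_zero {r : ℝ} (hr : 0 < r) : Ioo (-r) r ∈ nhds (0 : ℝ) :=
  Ioo_mem_nhds (by linarith) hr

variable {G : Subgroup Aˣ} {X Y : A}

/-- The velocity of a curve in `G` at an arbitrary point, translated to the identity. -/
lemma mul_inv_mem_lieAlg {r : ℝ} (hr : 0 < r) {γ : ℝ → Aˣ} (hγ : ∀ s ∈ Ioo (-r) r, γ s ∈ G)
    (hs : ContDiffOn ℝ ∞ (fun s => (γ s : A)) (Ioo (-r) r))
    (hX : HasDerivAt (fun s => (γ s : A)) X 0) : X * ((γ 0)⁻¹ : Aˣ) ∈ lieAlg G := by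
  refine ⟨r, hr, fun s => γ s * (γ 0)⁻¹, fun s h => mul_mem (hγ s h)
    (inv_mem (hγ 0 (zero_mem_Ioo hr))), ?_, by simp, ?_⟩
  · simpa using hs.mul contDiffOn_const
  · simpa using hX.mul_const _

lemma zero_mem_lieAlg : (0 : A) ∈ lieAlg G :=
  ⟨1, one_pos, fun _ => 1, fun _ _ => one_mem _, contDiffOn_const, rfl, hasDerivAt_const _ _⟩

lemma add_mem_lieAlg (hX : X ∈ lieAlg G) (hY : Y ∈ lieAlg G) : X + Y ∈ lieAlg G := by
  obtain ⟨r, hr, γ, hγ, hs, h1, h2⟩ := hX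
  obtain ⟨r', hr', γ', hγ', hs', h1', h2'⟩ := hY
  refine ⟨min r r', lt_min hr hr', fun s => γ s * γ' s, fun s h => mul_mem
    (hγ s (Ioo_subset_of_le (min_le_left _ _) h)) (hγ' s (Ioo_subset_of_le (min_le_right _ _) h)),
    ?_, by simp [h1, h1'], ?_⟩
  · simpa using (hs.mono (Ioo_subset_of_le (min_le_left _ _))).mul
      (hs'.mono (Ioo_subset_of_le (min_le_right _ _)))
  · simpa [h1, h1'] using hasDerivAt_mul_fun h2 h2'

lemma mul_mem_Ioo {r c s : ℝ} (hs : s ∈ Ioo (-(r / (|c| + 1))) (r / (|c| + 1))) :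
    c * s ∈ Ioo (-r) r := by
  have h0 : 0 < |c| + 1 := by positivity
  refine abs_lt.1 ?_
  rw [abs_mul]
  have h1 : |s| < r / (|c| + 1) := abs_lt.2 hs
  rw [lt_div_iff₀ h0] at h1
  nlinarith [abs_nonneg s, abs_nonneg c]

lemma smul_mem_lieAlg (c : ℝ) (hX : X ∈ lieAlg G) : c • X ∈ lieAlg G := by
  obtain ⟨r, hr, γ, hγ, hs, h1, h2⟩ := hX
  have hm : MapsTo (fun s : ℝ => c * s) (Ioo (-(r / (|c| + 1))) (r / (|c| + 1))) (Ioo (-r) r) :=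
    fun s h => mul_mem_Ioo h
  refine ⟨r / (|c| + 1), by positivity, fun s => γ (c * s), fun s h => hγ _ (hm h), ?_,
    by simp [h1], ?_⟩
  · exact hs.comp (by fun_prop) hm
  · have h3 : HasDerivAt (fun s : ℝ => c * s) c 0 := by
      simpa using (hasDerivAt_id (0 : ℝ)).const_mul c
    have h4 : HasDerivAt (fun s => (γ s : A)) X (c * 0) := by simpa using h2
    exact h4.scomp (0 : ℝ) h3

lemma conj_mem_lieAlg {g : Aˣ} (hg : g ∈ G) (hX : X ∈ lieAlg G) :
    (g : A) * X * (g⁻¹ : Aˣ) ∈ lieAlg G := by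
  obtain ⟨r, hr, γ, hγ, hs, h1, h2⟩ := hX
  refine ⟨r, hr, fun s => g * γ s * g⁻¹, fun s h => mul_mem (mul_mem hg (hγ s h)) (inv_mem hg), ?_,
    by simp [h1], ?_⟩
  · simpa using (contDiffOn_const.mul hs).mul contDiffOn_const
  · simpa using (h2.const_mul (g : A)).mul_const ((g⁻¹ : Aˣ) : A)

variable [FiniteDimensional ℂ A]

lemma ContDiffOn.units_inv {F : Type*} [NormedAddCommGroup F] [NormedSpace ℝ F] {u : F → Aˣ}
    {S : Set F} (h : ContDiffOn ℝ ∞ (fun x => (u x : A)) S) :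
    ContDiffOn ℝ ∞ (fun x => (((u x)⁻¹ : Aˣ) : A)) S := by
  have : CompleteSpace A := FiniteDimensional.complete ℂ A
  intro x hx
  have h1 := ContDiffAt.comp_contDiffWithinAt (f := fun x => (u x : A)) x
    (contDiffAt_ringInverse ℝ (u x)) (h x hx)
  simpa [Function.comp_def] using h1

lemma HasDerivAt.units_inv {u : ℝ → Aˣ} {u' : A} {s : ℝ}
    (h : HasDerivAt (fun x => (u x : A)) u' s) :
    HasDerivAt (fun x => (((u x)⁻¹ : Aˣ) : A)) (-(((u s)⁻¹ : Aˣ) * u' * ((u s)⁻¹ : Aˣ))) s := by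
  have : CompleteSpace A := FiniteDimensional.complete ℂ A
  have h1 := (hasFDerivAt_ringInverse (𝕜 := ℝ) (u s)).comp_hasDerivAt s h
  simpa [Function.comp_def] using h1

/-- The Lie algebra of a linear complex Lie group as a complex subspace of `A`. -/
def lieSubmodule (hG : IsComplexLieGroup G) : Submodule ℂ A where
  carrier := lieAlg G
  zero_mem' := zero_mem_lieAlg
  add_mem' := add_mem_lieAlg
  smul_mem' c X hX := by
    have e : c • X = c.re • X + c.im • (Complex.I • X) := by
      conv_lhs => rw [← Complex.re_add_im c]
      rw [add_smul, mul_smul, Complex.coe_smul, Complex.coe_smul]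
    rw [e]
    exact add_mem_lieAlg (smul_mem_lieAlg _ hX) (smul_mem_lieAlg _ (hG.complex _ hX))

lemma deriv_mem_lieAlg (hG : IsComplexLieGroup G) {φ : ℝ → A} {s : ℝ} (h : HasDerivAt φ X s)
    (hφ : ∀ᶠ x in nhds s, φ x ∈ lieAlg G) : X ∈ lieAlg G :=
  HasDerivAt.mem_of_isClosed (p := (lieSubmodule hG).restrictScalars ℝ)
    ((lieSubmodule hG).closed_of_finiteDimensional) h hφ

lemma bracket_mem_lieAlg (hG : IsComplexLieGroup G) (hX : X ∈ lieAlg G) (hY : Y ∈ lieAlg G) :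
    X * Y - Y * X ∈ lieAlg G := by
  obtain ⟨r, hr, γ, hγ, -, h1, h2⟩ := hX
  have h3 := hasDerivAt_mul_fun (h2.mul_const Y) (HasDerivAt.units_inv h2)
  refine deriv_mem_lieAlg hG (by simpa [h1, sub_eq_add_neg] using h3) ?_
  filter_upwards [Ioo_mem_nhds_zero hr] with s hs
  exact conj_mem_lieAlg (hγ s hs) hY

end LieAlgebra

/-! ### Loops and the derivative along the circle -/

section Loops

variable {A : Type*} [NormedRing A] [NormedAlgebra ℂ A] {X Y : Circle → A}

lemma dLam_exp (X : Circle → A) (t : ℝ) :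
    dLam X (Circle.exp t) =
      (Complex.I * (Circle.exp t : ℂ))⁻¹ • deriv (fun u : ℝ => X (Circle.exp u)) t := by
  rw [dLam]
  simp only [← Circle.exp_add]
  rw [deriv_comp_const_add (fun u : ℝ => X (Circle.exp u)) t 0, add_zero]

lemma I_mul_coe_ne_zero (z : Circle) : Complex.I * (z : ℂ) ≠ 0 :=
  mul_ne_zero Complex.I_ne_zero z.coe_ne_zero

lemma contDiff_rotate (hX : ContMDiff (𝓡 1) 𝓘(ℝ, A) ∞ X) (z : Circle) :
    ContDiff ℝ ∞ (fun t : ℝ => X (z * Circle.exp t)) := by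
  obtain ⟨t₀, rfl⟩ := Circle.exp_surjective z
  simp only [← Circle.exp_add]
  exact (contMDiff_circle_iff.1 hX).comp (by fun_prop)

lemma hasDerivAt_rotate (hX : ContMDiff (𝓡 1) 𝓘(ℝ, A) ∞ X) (z : Circle) :
    HasDerivAt (fun t : ℝ => X (z * Circle.exp t)) ((Complex.I * (z : ℂ)) • dLam X z) 0 := by
  rw [dLam, smul_smul, mul_inv_cancel₀ (I_mul_coe_ne_zero z), one_smul]
  exact (((contDiff_rotate hX z).differentiable (by simp)) 0).hasDerivAt

lemma dLam_eq_of_hasDerivAt {z : Circle} {D : A}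
    (h : HasDerivAt (fun t : ℝ => X (z * Circle.exp t)) ((Complex.I * (z : ℂ)) • D) 0) :
    dLam X z = D := by
  rw [dLam, h.deriv, smul_smul, inv_mul_cancel₀ (I_mul_coe_ne_zero z), one_smul]

lemma hasDerivAt_coe_rotate (z : Circle) :
    HasDerivAt (fun t : ℝ => ((z * Circle.exp t : Circle) : ℂ)) (Complex.I * z) 0 := by
  have h1 : HasDerivAt (fun t : ℝ => Complex.exp (t * Complex.I)) Complex.I 0 := by
    have := ((Complex.ofRealCLM.hasDerivAt (x := 0)).mul_const Complex.I).cexp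
    simpa using this
  simpa [Circle.coe_exp, mul_comm] using h1.const_mul (z : ℂ)

lemma contDiff_coe_exp_zpow (n : ℤ) : ContDiff ℝ ∞ (fun t : ℝ => (Circle.exp t : ℂ) ^ n) := by
  have : (fun t : ℝ => (Circle.exp t : ℂ) ^ n) =
      fun t : ℝ => Complex.exp (n * (t * Complex.I)) := by
    funext t
    rw [Circle.coe_exp, ← Complex.exp_int_mul]
  rw [this]
  exact Complex.contDiff_exp.comp
    (contDiff_const.mul (Complex.ofRealCLM.contDiff.mul contDiff_const))

lemma contMDiff_dLam (hX : ContMDiff (𝓡 1) 𝓘(ℝ, A) ∞ X) : ContMDiff (𝓡 1) 𝓘(ℝ, A) ∞ (dLam X) := by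
  rw [contMDiff_circle_iff] at hX ⊢
  simp only [dLam_exp]
  have h2 : ContDiff ℝ ∞ (deriv (fun u : ℝ => X (Circle.exp u))) :=
    (contDiff_infty_iff_deriv.1 hX).2
  have h3 : (fun t : ℝ => (Complex.I * (Circle.exp t : ℂ))⁻¹ •
      deriv (fun u : ℝ => X (Circle.exp u)) t) = fun t : ℝ => Complex.I⁻¹ •
        ((Circle.exp t : ℂ) ^ (-1 : ℤ) • deriv (fun u : ℝ => X (Circle.exp u)) t) := by
    funext t
    rw [mul_inv, zpow_neg_one, smul_smul]
  rw [h3]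
  exact ContDiff.const_smul Complex.I⁻¹ ((contDiff_coe_exp_zpow (-1)).smul h2)

lemma dLam_sub (hX : ContMDiff (𝓡 1) 𝓘(ℝ, A) ∞ X) (hY : ContMDiff (𝓡 1) 𝓘(ℝ, A) ∞ Y) (z : Circle) :
    dLam (X - Y) z = dLam X z - dLam Y z := by
  apply dLam_eq_of_hasDerivAt
  rw [smul_sub]
  exact (hasDerivAt_rotate hX z).sub (hasDerivAt_rotate hY z)

lemma dLam_zpow_smul (n : ℤ) (hX : ContMDiff (𝓡 1) 𝓘(ℝ, A) ∞ X) (z : Circle) :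
    dLam (fun w => (w : ℂ) ^ n • X w) z =
      (n : ℂ) • ((z : ℂ) ^ (n - 1) • X z) + (z : ℂ) ^ n • dLam X z := by
  apply dLam_eq_of_hasDerivAt
  have h1 : HasDerivAt (fun t : ℝ => ((z * Circle.exp t : Circle) : ℂ) ^ n)
      (Complex.I * z * (n * (z : ℂ) ^ (n - 1))) 0 := by
    have h2 : HasDerivAt (fun w : ℂ => w ^ n) (n * (z : ℂ) ^ (n - 1))
        ((z * Circle.exp 0 : Circle) : ℂ) := by
      simpa using hasDerivAt_zpow n (z : ℂ) (Or.inl z.coe_ne_zero)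
    have := h2.scomp (0 : ℝ) (hasDerivAt_coe_rotate z)
    simpa [Function.comp_def] using this
  have h3 := h1.smul (hasDerivAt_rotate hX z)
  refine h3.congr_deriv ?_
  simp only [Circle.exp_zero, mul_one, smul_add, smul_smul]
  rw [add_comm]
  congr 2
  all_goals ring

end Loops

/-! ### Curves of loops -/

section Curves

variable {A : Type*} [NormedRing A] [NormedAlgebra ℂ A]

/-- The curve `s ↦ W s`, `|s| < r`, of loops in `A` is smooth, jointly in `s` and the angle. -/
def SmoothFamily (r : ℝ) (W : ℝ → Circle → A) : Prop :=
  ContDiffOn ℝ ∞ (fun p : ℝ × ℝ => W p.1 (Circle.exp p.2)) (strip r)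

/-- The velocity at `s = 0` of a curve of loops. -/
noncomputable def loopDeriv (W : ℝ → Circle → A) (z : Circle) : A := deriv (fun s => W s z) 0

lemma smoothCurve_iff {r : ℝ} {γ : ℝ → Circle → Aˣ} :
    SmoothCurve r γ ↔ SmoothFamily r (fun s z => (γ s z : A)) := contMDiffOn_cylinder_iff

variable {r r' : ℝ} {W V : ℝ → Circle → A} {γ δ : ℝ → Circle → Aˣ}

lemma strip_mono (h : r' ≤ r) : strip r' ⊆ strip r := prod_mono (Ioo_subset_of_le h) subset_rfl

lemma SmoothFamily.mono (h : SmoothFamily r W) (hr : r' ≤ r) : SmoothFamily r' W :=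
  ContDiffOn.mono h (strip_mono hr)

lemma SmoothFamily.mul (h : SmoothFamily r W) (h' : SmoothFamily r V) :
    SmoothFamily r (fun s z => W s z * V s z) := ContDiffOn.mul h h'

lemma SmoothFamily.add (h : SmoothFamily r W) (h' : SmoothFamily r V) :
    SmoothFamily r (fun s z => W s z + V s z) := ContDiffOn.add h h'

lemma smoothFamily_const {X : Circle → A} (hX : ContMDiff (𝓡 1) 𝓘(ℝ, A) ∞ X) :
    SmoothFamily r (fun _ => X) :=
  ((contMDiff_circle_iff.1 hX).comp contDiff_snd).contDiffOn

lemma SmoothFamily.zpow_smul (h : SmoothFamily r W) (n : ℤ) :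
    SmoothFamily r (fun s z => (z : ℂ) ^ n • W s z) :=
  ((contDiff_coe_exp_zpow n).comp contDiff_snd).contDiffOn.smul h

lemma SmoothFamily.hasDerivAt (h : SmoothFamily r W) (hr : 0 < r) (z : Circle) :
    HasDerivAt (fun s => W s z) (loopDeriv W z) 0 := by
  obtain ⟨t, rfl⟩ := Circle.exp_surjective z
  exact (hasDerivAt_pS h (zero_mem_Ioo hr) t).differentiableAt.hasDerivAt

lemma SmoothFamily.loopDeriv_exp (h : SmoothFamily r W) (hr : 0 < r) (t : ℝ) :
    loopDeriv W (Circle.exp t) = pS (fun p : ℝ × ℝ => W p.1 (Circle.exp p.2)) (0, t) :=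
  (hasDerivAt_pS h (zero_mem_Ioo hr) t).deriv

lemma SmoothFamily.contMDiff_apply (h : SmoothFamily r W) {s : ℝ} (hs : s ∈ Ioo (-r) r) :
    ContMDiff (𝓡 1) 𝓘(ℝ, A) ∞ (W s) := by
  rw [contMDiff_circle_iff, contDiff_iff_contDiffAt]
  intro t
  exact (contDiffAt_of_strip h hs t).comp t (f := fun t : ℝ => (s, t)) (by fun_prop)

lemma SmoothFamily.contMDiff_loopDeriv (h : SmoothFamily r W) (hr : 0 < r) :
    ContMDiff (𝓡 1) 𝓘(ℝ, A) ∞ (loopDeriv W) := by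
  rw [contMDiff_circle_iff]
  simp only [h.loopDeriv_exp hr]
  rw [contDiff_iff_contDiffAt]
  intro t
  exact (contDiffAt_of_strip (contDiffOn_pS h) (zero_mem_Ioo hr) t).comp t
    (f := fun t : ℝ => ((0 : ℝ), t)) (by fun_prop)

lemma SmoothFamily.contDiffOn_apply (h : SmoothFamily r W) (z : Circle) :
    ContDiffOn ℝ ∞ (fun s => W s z) (Ioo (-r) r) := by
  obtain ⟨t, rfl⟩ := Circle.exp_surjective z
  exact ContDiffOn.comp (f := fun s : ℝ => (s, t)) h (by fun_prop) (fun s hs => mem_strip.2 hs)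

lemma SmoothFamily.dLam (h : SmoothFamily r W) : SmoothFamily r (fun s => dLam (W s)) := by
  have h2 : SmoothFamily r (fun s z => Complex.I⁻¹ • ((z : ℂ) ^ (-1 : ℤ) •
      deriv (fun t : ℝ => W s (z * Circle.exp t)) 0)) := by
    refine ContDiffOn.const_smul Complex.I⁻¹
      (((contDiff_coe_exp_zpow (-1)).comp contDiff_snd).contDiffOn.smul ?_)
    refine (contDiffOn_pT h).congr fun p hp => ?_
    simp only [← Circle.exp_add]
    rw [deriv_comp_const_add (fun u : ℝ => W p.1 (Circle.exp u)) p.2 0, add_zero]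
    exact (hasDerivAt_pT h (mem_strip.1 hp) p.2).deriv
  refine ContDiffOn.congr h2 fun p _ => ?_
  simp only [LoopVirasoro.dLam]
  rw [mul_inv, zpow_neg_one, smul_smul]

/-- The derivative along the circle commutes with the derivative in the parameter. -/
lemma SmoothFamily.hasDerivAt_dLam (h : SmoothFamily r W) (hr : 0 < r) (z : Circle) :
    HasDerivAt (fun s => LoopVirasoro.dLam (W s) z) (LoopVirasoro.dLam (loopDeriv W) z) 0 := by
  obtain ⟨t, rfl⟩ := Circle.exp_surjective z
  have h1 := (hasDerivAt_pS (contDiffOn_pT h) (zero_mem_Ioo hr) t)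
  rw [pS_pT_comm h (zero_mem_Ioo hr)] at h1
  have h2 : HasDerivAt (fun s => deriv (fun u : ℝ => W s (Circle.exp u)) t)
      (deriv (fun u : ℝ => loopDeriv W (Circle.exp u)) t) 0 := by
    simp only [h.loopDeriv_exp hr]
    rw [(hasDerivAt_pT (contDiffOn_pS h) (zero_mem_Ioo hr) t).deriv]
    refine h1.congr_of_eventuallyEq ?_
    filter_upwards [Ioo_mem_nhds_zero hr] with s hs
    exact (hasDerivAt_pT h hs t).deriv
  simp only [dLam_exp]
  exact h2.const_smul (Complex.I * (Circle.exp t : ℂ))⁻¹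

lemma SmoothCurve.mono (h : SmoothCurve r γ) (hr : r' ≤ r) : SmoothCurve r' γ :=
  smoothCurve_iff.2 ((smoothCurve_iff.1 h).mono hr)

lemma SmoothCurve.mul (h : SmoothCurve r γ) (h' : SmoothCurve r δ) :
    SmoothCurve r (fun s => γ s * δ s) := by
  rw [smoothCurve_iff] at *
  simpa using h.mul h'

variable {H : Subgroup (Circle → Aˣ)} {f g : Circle → Aˣ}

lemma IsCurveIn.mono (h : IsCurveIn H r γ f) (hr' : 0 < r') (hr : r' ≤ r) : IsCurveIn H r' γ f :=
  ⟨hr', fun s hs => h.mem s (Ioo_subset_of_le hr hs), SmoothCurve.mono h.smooth hr, h.zero⟩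

lemma IsCurveIn.mul (h : IsCurveIn H r γ f) (h' : IsCurveIn H r δ g) :
    IsCurveIn H r (fun s => γ s * δ s) (f * g) :=
  ⟨h.pos, fun s hs => mul_mem (h.mem s hs) (h'.mem s hs), SmoothCurve.mul h.smooth h'.smooth,
    by simp [h.zero, h'.zero]⟩

lemma IsCurveIn.comp_mul (h : IsCurveIn H r γ f) (c : ℝ) :
    IsCurveIn H (r / (|c| + 1)) (fun s => γ (c * s)) f := by
  have hr := h.pos
  refine ⟨by positivity, fun s hs => h.mem _ (mul_mem_Ioo hs), ?_, by simp [h.zero]⟩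
  refine smoothCurve_iff.2 (ContDiffOn.comp (f := fun p : ℝ × ℝ => (c * p.1, p.2))
    (smoothCurve_iff.1 h.smooth) (by fun_prop) fun p hp => ?_)
  exact mem_strip.2 (mul_mem_Ioo (mem_strip.1 hp))

lemma HasLoopVelocity.eq_loopDeriv {X : Circle → A} (h : HasLoopVelocity γ X) :
    (loopDeriv fun s z => (γ s z : A)) = X := funext fun z => (h z).deriv

variable [FiniteDimensional ℂ A]

lemma SmoothFamily.units_inv (h : SmoothFamily r (fun s z => (γ s z : A))) :
    SmoothFamily r (fun s z => (((γ s z)⁻¹ : Aˣ) : A)) := ContDiffOn.units_inv h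

lemma SmoothCurve.inv (h : SmoothCurve r γ) : SmoothCurve r (fun s => (γ s)⁻¹) := by
  rw [smoothCurve_iff] at *
  exact h.units_inv

lemma smoothCurve_const {G : Subgroup Aˣ} {f : Circle → Aˣ} (hf : f ∈ loopGroup G) :
    SmoothCurve r (fun _ => f) := smoothCurve_iff.2 (smoothFamily_const hf.1)

lemma isCurveIn_const {G : Subgroup Aˣ} (hr : 0 < r) (hf : f ∈ H) (hH : H ≤ loopGroup G) :
    IsCurveIn H r (fun _ => f) f :=
  ⟨hr, fun _ _ => hf, smoothCurve_const (hH hf), rfl⟩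

lemma IsCurveIn.mul_inv_const {G : Subgroup Aˣ} (hH : H ≤ loopGroup G) (h : IsCurveIn H r γ f) :
    IsCurveIn H r (fun s => γ s * f⁻¹) 1 := by
  have hf : f ∈ H := h.zero ▸ h.mem 0 (zero_mem_Ioo h.pos)
  simpa using h.mul (isCurveIn_const h.pos (inv_mem hf) hH)

end Curves

/-! ### The loop algebra -/

section LoopAlgebra

variable {A : Type*} [NormedRing A] [NormedAlgebra ℂ A] {G : Subgroup Aˣ} {X Y : Circle → A} {r : ℝ}
  {W : ℝ → Circle → A}

/-- `𝓛` as a complex subspace of the space of all loops in `A`. -/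
def loopSubmodule (hG : IsComplexLieGroup G) : Submodule ℂ (Circle → A) where
  carrier := loopAlg G
  zero_mem' := ⟨contMDiff_const, fun _ => zero_mem_lieAlg⟩
  add_mem' := fun {a b} ha hb => ⟨by
      have h := ha.1; have h' := hb.1
      rw [contMDiff_circle_iff] at *
      exact h.add h', fun z => add_mem_lieAlg (ha.2 z) (hb.2 z)⟩
  smul_mem' c X hX := ⟨by
      have h := hX.1
      rw [contMDiff_circle_iff] at *
      exact ContDiff.const_smul c h, fun z => (lieSubmodule hG).smul_mem c (hX.2 z)⟩

lemma zpow_smul_mem_loopAlg (hG : IsComplexLieGroup G) (n : ℤ) (hX : X ∈ loopAlg G) :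
    (fun z : Circle => (z : ℂ) ^ n • X z) ∈ loopAlg G := by
  refine ⟨?_, fun z => (lieSubmodule hG).smul_mem _ (hX.2 z)⟩
  have h := hX.1
  rw [contMDiff_circle_iff] at *
  exact (contDiff_coe_exp_zpow n).smul h

variable [FiniteDimensional ℂ A]

lemma bracket_mem_loopAlg (hG : IsComplexLieGroup G) (hX : X ∈ loopAlg G) (hY : Y ∈ loopAlg G) :
    X * Y - Y * X ∈ loopAlg G := by
  refine ⟨?_, fun z => bracket_mem_lieAlg hG (hX.2 z) (hY.2 z)⟩
  have h := hX.1
  have h' := hY.1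
  rw [contMDiff_circle_iff] at *
  exact (h.mul h').sub (h'.mul h)

lemma dLam_mem_loopAlg (hG : IsComplexLieGroup G) (hX : X ∈ loopAlg G) : dLam X ∈ loopAlg G := by
  refine ⟨contMDiff_dLam hX.1, fun z => ?_⟩
  have h1 := deriv_mem_lieAlg hG (hasDerivAt_rotate hX.1 z)
    (Filter.Eventually.of_forall fun t => hX.2 _)
  have h2 := (lieSubmodule hG).smul_mem (Complex.I * (z : ℂ))⁻¹ h1
  rwa [smul_smul, inv_mul_cancel₀ (I_mul_coe_ne_zero z), one_smul] at h2

lemma loopDeriv_mem_loopAlg (hG : IsComplexLieGroup G) (hr : 0 < r) (hW : SmoothFamily r W)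
    (h : ∀ s ∈ Ioo (-r) r, W s ∈ loopAlg G) : loopDeriv W ∈ loopAlg G := by
  refine ⟨hW.contMDiff_loopDeriv hr, fun z => deriv_mem_lieAlg hG (hW.hasDerivAt hr z) ?_⟩
  filter_upwards [Ioo_mem_nhds_zero hr] with s hs
  exact (h s hs).2 z

lemma velocity_mem_loopAlg {γ : ℝ → Circle → Aˣ} (h : IsCurveIn (loopGroup G) r γ 1) :
    (loopDeriv fun s z => (γ s z : A)) ∈ loopAlg G := by
  have h1 := smoothCurve_iff.1 h.smooth
  refine ⟨h1.contMDiff_loopDeriv h.pos, fun z => ?_⟩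
  exact ⟨r, h.pos, fun s => γ s z, fun s hs => (h.mem s hs).2 z, h1.contDiffOn_apply z,
    congrFun h.zero z, h1.hasDerivAt h.pos z⟩

lemma conj_mem_loopAlg {f : Circle → Aˣ} (hf : f ∈ loopGroup G) (hX : X ∈ loopAlg G) :
    (fun z => (f z : A) * X z * ((f z)⁻¹ : Aˣ)) ∈ loopAlg G := by
  refine ⟨?_, fun z => conj_mem_lieAlg (hf.2 z) (hX.2 z)⟩
  have h := hX.1
  have h' := hf.1
  have h'' := (inv_mem hf).1
  rw [contMDiff_circle_iff] at *
  exact (h'.mul h).mul h''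

lemma dLam_mul_inv_mem_loopAlg (hG : IsComplexLieGroup G) {f : Circle → Aˣ} (hf : f ∈ loopGroup G) :
    (fun z => dLam (fun w => (f w : A)) z * ((f z)⁻¹ : Aˣ)) ∈ loopAlg G := by
  refine ⟨?_, fun z => ?_⟩
  · have h := contMDiff_dLam hf.1
    have h'' := (inv_mem hf).1
    rw [contMDiff_circle_iff] at *
    exact h.mul h''
  · have h1 := mul_inv_mem_lieAlg (γ := fun t => f (z * Circle.exp t)) one_pos (fun s _ => hf.2 _)
      (contDiff_rotate hf.1 z).contDiffOn (hasDerivAt_rotate hf.1 z)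
    simp only [Circle.exp_zero, mul_one] at h1
    have h2 := (lieSubmodule hG).smul_mem (Complex.I * (z : ℂ))⁻¹ h1
    rwa [smul_mul_assoc, smul_smul, inv_mul_cancel₀ (I_mul_coe_ne_zero z), one_smul] at h2

end LoopAlgebra

/-! ### First-order expansion of a curve of loops -/

section Remainder

variable {A : Type*} [NormedRing A] [NormedAlgebra ℂ A] {r : ℝ} {W : ℝ → Circle → A}

/-- A smooth curve of loops is differentiable at `s = 0` for the topology of uniform convergence
of all derivatives. -/
lemma SmoothFamily.remainder (h : SmoothFamily r W) (hr : 0 < r) {c : ℝ} (hc : 0 < c) (N : ℕ) :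
    ∃ δ > 0, δ ≤ r ∧ ∀ s ∈ Ioo (-δ) δ, ∀ i ≤ N, ∀ t, ‖iteratedDeriv i
      (fun u : ℝ => (W s - W 0 - s • loopDeriv W) (Circle.exp u)) t‖ ≤ c * |s| := by
  have h0 : ContDiffOn ℝ ∞ (fun p : ℝ × ℝ => W 0 (Circle.exp p.2)) (strip r) :=
    smoothFamily_const (h.contMDiff_apply (zero_mem_Ioo hr))
  have h1 : ContDiffOn ℝ ∞ (fun p : ℝ × ℝ => loopDeriv W (Circle.exp p.2)) (strip r) :=
    smoothFamily_const (h.contMDiff_loopDeriv hr)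
  have h2 : ContDiffOn ℝ ∞ (fun p : ℝ × ℝ => (W p.1 - W 0 - p.1 • loopDeriv W) (Circle.exp p.2))
      (strip r) := (ContDiffOn.sub h h0).sub (contDiffOn_fst.smul h1)
  refine uniform_littleO_iteratedDeriv hr h2 Real.two_pi_pos (fun s t => ?_) (fun t => by simp)
    (fun t => ?_) hc N
  · simp only [Circle.exp_add_two_pi]
  · have h3 := hasDerivAt_pS h2 (zero_mem_Ioo hr) t
    have h4 := ((h.hasDerivAt hr (Circle.exp t)).sub_const (W 0 (Circle.exp t))).sub
      ((hasDerivAt_id (0 : ℝ)).smul_const (loopDeriv W (Circle.exp t)))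
    simp only [one_smul, sub_self] at h4
    exact h3.unique h4

end Remainder

/-! ### Holomorphic extension to the disc -/

section Extension

variable {A : Type*} [NormedRing A] [NormedAlgebra ℂ A] {G : Subgroup Aˣ} {X Y : Circle → A} {r : ℝ}
  {W : ℝ → Circle → A}

/-- The loop `X` is the boundary value of a holomorphic map of the unit disc, continuous on the
closed disc. -/
def HasDiscExtension (X : Circle → A) : Prop :=
  ∃ F : ℂ → A, DiffContOnCl ℂ F (ball 0 1) ∧ ∀ z : Circle, F z = X z

lemma HasDiscExtension.sub (hX : HasDiscExtension X) (hY : HasDiscExtension Y) :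
    HasDiscExtension (X - Y) := by
  obtain ⟨F, hF, hFe⟩ := hX
  obtain ⟨H, hH, hHe⟩ := hY
  exact ⟨F - H, hF.sub hH, fun z => by simp [hFe, hHe]⟩

lemma HasDiscExtension.add (hX : HasDiscExtension X) (hY : HasDiscExtension Y) :
    HasDiscExtension (X + Y) := by
  obtain ⟨F, hF, hFe⟩ := hX
  obtain ⟨H, hH, hHe⟩ := hY
  exact ⟨F + H, hF.add hH, fun z => by simp [hFe, hHe]⟩

lemma HasDiscExtension.smul (c : ℂ) (hX : HasDiscExtension X) : HasDiscExtension (c • X) := by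
  obtain ⟨F, hF, hFe⟩ := hX
  exact ⟨c • F, hF.const_smul c, fun z => by simp [hFe]⟩

lemma HasDiscExtension.mul (hX : HasDiscExtension X) (hY : HasDiscExtension Y) :
    HasDiscExtension (X * Y) := by
  obtain ⟨F, hF, hFe⟩ := hX
  obtain ⟨H, hH, hHe⟩ := hY
  exact ⟨F * H, ⟨hF.differentiableOn.mul hH.differentiableOn, hF.continuousOn.mul hH.continuousOn⟩,
    fun z => by simp [hFe, hHe]⟩

lemma HasDiscExtension.pow_smul (n : ℕ) (hX : HasDiscExtension X) :
    HasDiscExtension (fun z : Circle => (z : ℂ) ^ n • X z) := by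
  obtain ⟨F, hF, hFe⟩ := hX
  exact ⟨fun z => z ^ n • F z, (differentiable_id.pow n).diffContOnCl.smul hF,
    fun z => by simp [hFe]⟩

/-- The maximum principle makes the boundary values of holomorphic maps closed under uniform
limits. -/
lemma hasDiscExtension_of_approx [CompleteSpace A]
    (h : ∀ c > 0, ∃ Y : Circle → A, HasDiscExtension Y ∧ ∀ z, ‖Y z - X z‖ ≤ c) :
    HasDiscExtension X := by
  have hu : ∀ n : ℕ, ∃ F : ℂ → A, DiffContOnCl ℂ F (ball 0 1) ∧
      ∀ z : Circle, ‖F z - X z‖ ≤ 1 / ((n : ℝ) + 1) := fun n => by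
    obtain ⟨Y, ⟨F, hF, hFe⟩, hY⟩ := h (1 / ((n : ℝ) + 1)) (by positivity)
    exact ⟨F, hF, fun z => by rw [hFe]; exact hY z⟩
  choose F hF hFX using hu
  have hcauchy : UniformCauchySeqOn F Filter.atTop (closedBall (0 : ℂ) 1) := by
    rw [Metric.uniformCauchySeqOn_iff]
    intro e he
    obtain ⟨N, hN⟩ := exists_nat_one_div_lt (half_pos he)
    refine ⟨N, fun m hm n hn x hx => ?_⟩
    have hb : ∀ m ≥ N, ∀ z : Circle, ‖F m z - X z‖ ≤ 1 / ((N : ℝ) + 1) := fun m hm z =>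
      (hFX m z).trans (one_div_le_one_div_of_le (by positivity)
        (by gcongr))
    rw [dist_eq_norm]
    have key := Complex.norm_le_of_forall_mem_frontier_norm_le (f := F m - F n)
      (C := 1 / ((N : ℝ) + 1) + 1 / ((N : ℝ) + 1)) isBounded_ball ((hF m).sub (hF n))
      (fun w hw => by
        rw [frontier_ball _ one_ne_zero] at hw
        have e : ((⟨w, hw⟩ : Circle) : ℂ) = w := rfl
        rw [← e]
        calc ‖(F m - F n) ((⟨w, hw⟩ : Circle) : ℂ)‖ = ‖(F m ((⟨w, hw⟩ : Circle) : ℂ) - X ⟨w, hw⟩) -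
              (F n ((⟨w, hw⟩ : Circle) : ℂ) - X ⟨w, hw⟩)‖ := by simp
          _ ≤ _ := (norm_sub_le _ _).trans (add_le_add (hb m hm _) (hb n hn _)))
      (z := x) (by rwa [closure_ball _ one_ne_zero])
    have : ‖F m x - F n x‖ ≤ 1 / ((N : ℝ) + 1) + 1 / ((N : ℝ) + 1) := key
    linarith
  have hlim : ∀ z : ℂ, ∃ L : A, z ∈ closedBall (0 : ℂ) 1 →
      Filter.Tendsto (fun n => F n z) Filter.atTop (nhds L) := fun z => by
    by_cases hz : z ∈ closedBall (0 : ℂ) 1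
    · obtain ⟨L, hL⟩ := cauchySeq_tendsto_of_complete (hcauchy.cauchySeq hz)
      exact ⟨L, fun _ => hL⟩
    · exact ⟨0, fun h => absurd h hz⟩
  choose L hL using hlim
  have hunif : TendstoUniformlyOn F L Filter.atTop (closedBall (0 : ℂ) 1) :=
    hcauchy.tendstoUniformlyOn_of_tendsto hL
  refine ⟨L, ⟨?_, ?_⟩, fun z => ?_⟩
  · exact ((hunif.mono ball_subset_closedBall).tendstoLocallyUniformlyOn).differentiableOn
      (Filter.Eventually.of_forall fun n => (hF n).differentiableOn) isOpen_ball
  · rw [closure_ball _ one_ne_zero]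
    refine hunif.continuousOn
      (Filter.Eventually.frequently (Filter.Eventually.of_forall fun n => ?_))
    have := (hF n).continuousOn
    rwa [closure_ball _ one_ne_zero] at this
  · have h1 := hL z (by simp [Circle.norm_coe])
    have h2 : Filter.Tendsto (fun n => F n z) Filter.atTop (nhds (X z)) := by
      rw [tendsto_iff_norm_sub_tendsto_zero]
      exact squeeze_zero (fun _ => norm_nonneg _) (fun n => hFX n z)
        tendsto_one_div_add_atTop_nhds_zero_nat
    exact tendsto_nhds_unique h1 h2

variable [FiniteDimensional ℂ A]

lemma SmoothFamily.hasDiscExtension_loopDeriv (hr : 0 < r) (hW : SmoothFamily r W)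
    (h : ∀ s ∈ Ioo (-r) r, HasDiscExtension (W s)) : HasDiscExtension (loopDeriv W) := by
  have : CompleteSpace A := FiniteDimensional.complete ℂ A
  refine hasDiscExtension_of_approx fun c hc => ?_
  obtain ⟨δ, hδ, hδr, H⟩ := hW.remainder hr hc 0
  have hs : δ / 2 ∈ Ioo (-δ) δ := ⟨by linarith, by linarith⟩
  have hne : (δ / 2 : ℝ) ≠ 0 := by positivity
  refine ⟨((δ / 2 : ℝ) : ℂ)⁻¹ • (W (δ / 2) - W 0), ((h _ (Ioo_subset_of_le hδr hs)).sub
    (h 0 (zero_mem_Ioo hr))).smul _, fun z => ?_⟩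
  obtain ⟨t, rfl⟩ := Circle.exp_surjective z
  have h1 := H _ hs 0 le_rfl t
  simp only [iteratedDeriv_zero, Pi.sub_apply, Pi.smul_apply] at h1
  have e : (((δ / 2 : ℝ) : ℂ)⁻¹ • (W (δ / 2) - W 0)) (Circle.exp t) - loopDeriv W (Circle.exp t) =
      (δ / 2)⁻¹ • (W (δ / 2) (Circle.exp t) - W 0 (Circle.exp t) -
        (δ / 2) • loopDeriv W (Circle.exp t)) := by
    rw [smul_sub (δ / 2)⁻¹, inv_smul_smul₀ hne, Pi.smul_apply, ← Complex.ofReal_inv,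
      Complex.coe_smul]
    rfl
  rw [e, norm_smul, norm_inv, Real.norm_eq_abs]
  rw [inv_mul_le_iff₀ (abs_pos.2 hne), mul_comm]
  exact h1

/-- If `X` extends holomorphically to the disc, so does `dX/dλ`. The difference quotients in the
angle, divided by `λ`, have removable singularities at the origin. -/
lemma HasDiscExtension.dLam (hs : ContMDiff (𝓡 1) 𝓘(ℝ, A) ∞ X) (hX : HasDiscExtension X) :
    HasDiscExtension (dLam X) := by
  obtain ⟨F, hF, hFe⟩ := hX
  have hsm : SmoothFamily 1 (fun s z => X (z * Circle.exp s) - X z) := by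
    have h1 : ContDiff ℝ ∞ (fun p : ℝ × ℝ => X (Circle.exp (p.2 + p.1))) :=
      (contMDiff_circle_iff.1 hs).comp (contDiff_snd.add contDiff_fst)
    have h2 : ContDiff ℝ ∞ (fun p : ℝ × ℝ => X (Circle.exp p.2)) :=
      (contMDiff_circle_iff.1 hs).comp contDiff_snd
    simp only [Circle.exp_add] at h1
    exact (h1.sub h2).contDiffOn
  have hW := hsm.zpow_smul (-1)
  have hext := SmoothFamily.hasDiscExtension_loopDeriv one_pos hW fun s _ => ?_
  · have e : (loopDeriv fun s z => (z : ℂ) ^ (-1 : ℤ) • (X (z * Circle.exp s) - X z)) =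
        Complex.I • LoopVirasoro.dLam X := by
      funext z
      have h3 := ((hasDerivAt_rotate hs z).sub_const (X z)).const_smul ((z : ℂ) ^ (-1 : ℤ))
      have h4 := h3.deriv
      rw [loopDeriv]
      refine h4.trans ?_
      rw [smul_smul, zpow_neg_one, mul_comm Complex.I, inv_mul_cancel_left₀ z.coe_ne_zero]
      rfl
    rw [e] at hext
    have := hext.smul Complex.I⁻¹
    rwa [smul_smul, inv_mul_cancel₀ Complex.I_ne_zero, one_smul] at this
  · set c : ℂ := (Circle.exp s : ℂ) with hc
    have hcn : ‖c‖ = 1 := Circle.norm_coe _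
    have hH : DiffContOnCl ℂ (fun z => F (z * c) - F z) (ball 0 1) := by
      refine DiffContOnCl.sub (hF.comp (g := fun z : ℂ => z * c) ?_ ?_) hF
      · exact (differentiable_id.mul_const c).diffContOnCl
      · intro z hz
        simpa [hcn] using hz
    have hn : ball (0 : ℂ) 1 ∈ nhds (0 : ℂ) := ball_mem_nhds _ one_pos
    refine ⟨dslope (fun z => F (z * c) - F z) 0, ⟨?_, ?_⟩, fun z => ?_⟩
    · exact (Complex.differentiableOn_dslope hn).2 hH.differentiableOn
    · exact (continuousOn_dslope (Filter.mem_of_superset hn subset_closure)).2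
        ⟨hH.continuousOn, hH.differentiableAt isOpen_ball (mem_ball_self one_pos)⟩
    · rw [dslope_of_ne _ z.coe_ne_zero, slope_def_module]
      simp only [sub_zero, zero_mul, sub_self, zpow_neg_one]
      rw [hc, ← Circle.coe_mul, hFe, hFe]

end Extension

/-! ### The algebra of `L₊` -/

section PlusAlgebra

variable {A : Type*} [NormedRing A] [NormedAlgebra ℂ A] {G : Subgroup Aˣ} {X Y : Circle → A} {r : ℝ}
  {W : ℝ → Circle → A}

/-- `𝓛₊` as a complex subspace of the space of all loops in `A`. -/
def plusSubmodule (hG : IsComplexLieGroup G) : Submodule ℂ (Circle → A) where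
  carrier := plusAlg G
  zero_mem' := ⟨(loopSubmodule hG).zero_mem, 0, diffContOnCl_const, fun _ => rfl⟩
  add_mem' := fun ha hb => ⟨(loopSubmodule hG).add_mem ha.1 hb.1, HasDiscExtension.add ha.2 hb.2⟩
  smul_mem' c _ hX := ⟨(loopSubmodule hG).smul_mem c hX.1, HasDiscExtension.smul c hX.2⟩

lemma pow_smul_mem_plusAlg (hG : IsComplexLieGroup G) {n : ℤ} (hn : 0 ≤ n) (hX : X ∈ plusAlg G) :
    (fun z : Circle => (z : ℂ) ^ n • X z) ∈ plusAlg G := by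
  refine ⟨zpow_smul_mem_loopAlg hG n hX.1, ?_⟩
  lift n to ℕ using hn
  simpa [HasDiscExtension] using HasDiscExtension.pow_smul n hX.2

variable [FiniteDimensional ℂ A]

lemma bracket_mem_plusAlg (hG : IsComplexLieGroup G) (hX : X ∈ plusAlg G) (hY : Y ∈ plusAlg G) :
    X * Y - Y * X ∈ plusAlg G :=
  ⟨bracket_mem_loopAlg hG hX.1 hY.1, (HasDiscExtension.mul hX.2 hY.2).sub
    (HasDiscExtension.mul hY.2 hX.2)⟩

lemma dLam_mem_plusAlg (hG : IsComplexLieGroup G) (hX : X ∈ plusAlg G) : dLam X ∈ plusAlg G :=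
  ⟨dLam_mem_loopAlg hG hX.1, HasDiscExtension.dLam hX.1.1 hX.2⟩

lemma velocity_mem_plusAlg {γ : ℝ → Circle → Aˣ} (h : IsCurveIn (plusGroup G) r γ 1) :
    (loopDeriv fun s z => (γ s z : A)) ∈ plusAlg G := by
  refine ⟨velocity_mem_loopAlg ⟨h.pos, fun s hs => (h.mem s hs).1, h.smooth, h.zero⟩,
    SmoothFamily.hasDiscExtension_loopDeriv h.pos (smoothCurve_iff.1 h.smooth) fun s hs => ?_⟩
  obtain ⟨F, hF, -, hFe⟩ := (h.mem s hs).2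
  exact ⟨F, hF, hFe⟩

end PlusAlgebra

/-! ### The algebra of `L₋` and the projection onto it -/

section MinusAlgebra

variable {A : Type*} [NormedRing A] [NormedAlgebra ℂ A] [FiniteDimensional ℂ A] {G : Subgroup Aˣ}
  {X Y : Circle → A} {r : ℝ} {W : ℝ → Circle → A} {Lm : Subgroup (Circle → Aˣ)}

/-- `𝓛₋` as a real subspace of the space of all loops in `A`. -/
def minusSubmodule (hL : Lm ≤ loopGroup G) : Submodule ℝ (Circle → A) where
  carrier := loopLieAlg Lm
  zero_mem' := ⟨1, fun _ => 1, isCurveIn_const one_pos (one_mem _) hL,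
    fun _ => hasDerivAt_const _ _⟩
  add_mem' := by
    rintro X Y ⟨r, γ, hγ, hX⟩ ⟨r', γ', hγ', hY⟩
    have hp := lt_min hγ.pos hγ'.pos
    refine ⟨min r r', _, by
      simpa using (hγ.mono hp (min_le_left _ _)).mul (hγ'.mono hp (min_le_right _ _)), fun z => ?_⟩
    simpa [hγ.zero, hγ'.zero] using hasDerivAt_mul_fun (hX z) (hY z)
  smul_mem' := by
    rintro c X ⟨r, γ, hγ, hX⟩
    refine ⟨_, _, hγ.comp_mul c, fun z => ?_⟩
    have h3 : HasDerivAt (fun s : ℝ => c * s) c 0 := by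
      simpa using (hasDerivAt_id (0 : ℝ)).const_mul c
    have h4 : HasDerivAt (fun s => (γ s z : A)) (X z) (c * 0) := by simpa using hX z
    exact h4.scomp (0 : ℝ) h3

lemma loopLieAlg_subset_loopAlg (hL : Lm ≤ loopGroup G) (hX : X ∈ loopLieAlg Lm) :
    X ∈ loopAlg G := by
  obtain ⟨r, γ, hγ, hX⟩ := hX
  rw [← hX.eq_loopDeriv]
  exact velocity_mem_loopAlg ⟨hγ.pos, fun s hs => hL (hγ.mem s hs), hγ.smooth, hγ.zero⟩

/-- The right logarithmic derivative of a curve in `L₋` lies in `𝓛₋`. -/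
lemma velocity_mul_inv_mem (hL : Lm ≤ loopGroup G) {γ : ℝ → Circle → Aˣ} {f : Circle → Aˣ}
    (hγ : IsCurveIn Lm r γ f) (hX : HasLoopVelocity γ X) :
    (fun z => X z * ((f z)⁻¹ : Aˣ)) ∈ loopLieAlg Lm :=
  ⟨r, _, hγ.mul_inv_const hL, fun z => by simpa using (hX z).mul_const (((f z)⁻¹ : Aˣ) : A)⟩

lemma conj_mem_loopLieAlg (hL : Lm ≤ loopGroup G) {f : Circle → Aˣ} (hf : f ∈ Lm)
    (hX : X ∈ loopLieAlg Lm) : (fun z => (f z : A) * X z * ((f z)⁻¹ : Aˣ)) ∈ loopLieAlg Lm := by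
  obtain ⟨r, γ, hγ, hX⟩ := hX
  have h1 := ((isCurveIn_const hγ.pos hf hL).mul hγ).mul
    (isCurveIn_const hγ.pos (inv_mem hf) hL)
  refine ⟨r, _, by simpa using h1, fun z => ?_⟩
  simpa using ((hX z).const_mul (f z : A)).mul_const (((f z)⁻¹ : Aˣ) : A)

lemma isMinusPart_minusPart (hL : IsSplitting G Lm) (hX : X ∈ loopAlg G) :
    IsMinusPart G Lm X (minusPart G Lm X) :=
  Classical.epsilon_spec (hL.alg_add X hX)

lemma minusPart_eq (hG : IsComplexLieGroup G) (hL : IsSplitting G Lm) (h : IsMinusPart G Lm X Y) :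
    minusPart G Lm X = Y := by
  have h' : IsMinusPart G Lm X (minusPart G Lm X) := Classical.epsilon_spec ⟨Y, h⟩
  have h1 : minusPart G Lm X - Y ∈ loopLieAlg Lm := (minusSubmodule hL.le).sub_mem h'.1 h.1
  have h2 : minusPart G Lm X - Y ∈ plusAlg G := by
    have := (plusSubmodule hG).sub_mem h.2 h'.2
    rwa [sub_sub_sub_cancel_left] at this
  have h3 : minusPart G Lm X - Y ∈ ({0} : Set (Circle → A)) := hL.alg_inter ▸ ⟨h2, h1⟩
  exact sub_eq_zero.1 h3

lemma IsMinusPart.add {X' Y' : Circle → A} (hG : IsComplexLieGroup G) (hL : IsSplitting G Lm)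
    (h : IsMinusPart G Lm X Y) (h' : IsMinusPart G Lm X' Y') :
    IsMinusPart G Lm (X + X') (Y + Y') :=
  ⟨(minusSubmodule hL.le).add_mem h.1 h'.1, by
    rw [add_sub_add_comm]; exact (plusSubmodule hG).add_mem h.2 h'.2⟩

lemma IsMinusPart.sub {X' Y' : Circle → A} (hG : IsComplexLieGroup G) (hL : IsSplitting G Lm)
    (h : IsMinusPart G Lm X Y) (h' : IsMinusPart G Lm X' Y') :
    IsMinusPart G Lm (X - X') (Y - Y') :=
  ⟨(minusSubmodule hL.le).sub_mem h.1 h'.1, by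
    rw [sub_sub_sub_comm]; exact (plusSubmodule hG).sub_mem h.2 h'.2⟩

lemma IsMinusPart.smul (hG : IsComplexLieGroup G) (hL : IsSplitting G Lm) (c : ℝ)
    (h : IsMinusPart G Lm X Y) : IsMinusPart G Lm (c • X) (c • Y) :=
  ⟨(minusSubmodule hL.le).smul_mem c h.1, by
    rw [← smul_sub]; exact ((plusSubmodule hG).restrictScalars ℝ).smul_mem c h.2⟩

/-- The projection to `𝓛₋` is continuous, so it commutes with the derivative of a curve. -/
lemma hasDerivAt_minusPart (hG : IsComplexLieGroup G) (hL : IsSplitting G Lm) (hr : 0 < r)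
    (hW : SmoothFamily r W) (h : ∀ s ∈ Ioo (-r) r, W s ∈ loopAlg G) (z : Circle) :
    HasDerivAt (fun s => minusPart G Lm (W s) z) (minusPart G Lm (loopDeriv W) z) 0 := by
  obtain ⟨M, K, hK⟩ := hL.continuous_proj 0
  rw [hasDerivAt_iff_isLittleO, Asymptotics.isLittleO_iff]
  intro c hc
  obtain ⟨δ, hδ, hδr, H⟩ := hW.remainder hr (c := c / (|K| + 1)) (by positivity) M
  filter_upwards [Ioo_mem_nhds_zero hδ] with s hs
  have hsr := Ioo_subset_of_le hδr hs
  have hm : IsMinusPart G Lm (W s - W 0 - s • loopDeriv W)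
      (minusPart G Lm (W s) - minusPart G Lm (W 0) - s • minusPart G Lm (loopDeriv W)) :=
    ((isMinusPart_minusPart hL (h s hsr)).sub hG hL
      (isMinusPart_minusPart hL (h 0 (zero_mem_Ioo hr)))).sub hG hL
      ((isMinusPart_minusPart hL (loopDeriv_mem_loopAlg hG hr hW h)).smul hG hL s)
  have hmem : W s - W 0 - s • loopDeriv W ∈ loopAlg G :=
    ((loopSubmodule hG).restrictScalars ℝ).sub_mem
      (((loopSubmodule hG).restrictScalars ℝ).sub_mem (h s hsr) (h 0 (zero_mem_Ioo hr)))
      (((loopSubmodule hG).restrictScalars ℝ).smul_mem s (loopDeriv_mem_loopAlg hG hr hW h))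
  obtain ⟨t, rfl⟩ := Circle.exp_surjective z
  have key := hK _ hmem _ hm (c / (|K| + 1) * |s|) (H s hs) 0 le_rfl t
  simp only [iteratedDeriv_zero, Pi.sub_apply, Pi.smul_apply] at key
  rw [sub_zero, Real.norm_eq_abs]
  refine key.trans ?_
  have h1 : K * (c / (|K| + 1) * |s|) ≤ (|K| + 1) * (c / (|K| + 1) * |s|) := by
    have : K ≤ |K| + 1 := (le_abs_self K).trans (by linarith)
    gcongr
  refine h1.trans (le_of_eq ?_)
  field_simp

/-- `𝓛₋` is closed under brackets: `[X, Y]` is the derivative of the conjugates of `Y` along a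
curve with velocity `X`, and `𝓛₋` is closed in `𝓛`. -/
lemma bracket_mem_loopLieAlg (hG : IsComplexLieGroup G) (hL : IsSplitting G Lm)
    (hX : X ∈ loopLieAlg Lm) (hY : Y ∈ loopLieAlg Lm) : X * Y - Y * X ∈ loopLieAlg Lm := by
  have hYs := (loopLieAlg_subset_loopAlg hL.le hY).1
  obtain ⟨r, γ, hγ, hX⟩ := hX
  have hsm := smoothCurve_iff.1 hγ.smooth
  have hW : SmoothFamily r (fun s z => (γ s z : A) * Y z * ((γ s z)⁻¹ : Aˣ)) :=
    (hsm.mul (smoothFamily_const hYs)).mul hsm.units_inv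
  have hmem : ∀ s ∈ Ioo (-r) r,
      (fun z => (γ s z : A) * Y z * ((γ s z)⁻¹ : Aˣ)) ∈ loopLieAlg Lm :=
    fun s hs => conj_mem_loopLieAlg hL.le (hγ.mem s hs) hY
  have hmem' := fun s hs => loopLieAlg_subset_loopAlg hL.le (hmem s hs)
  have e : (loopDeriv fun s z => (γ s z : A) * Y z * ((γ s z)⁻¹ : Aˣ)) = X * Y - Y * X := by
    funext z
    have h3 := hasDerivAt_mul_fun ((hX z).mul_const (Y z)) (HasDerivAt.units_inv (hX z))
    rw [loopDeriv, h3.deriv]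
    simp [hγ.zero, sub_eq_add_neg]
  -- the conjugates of `Y` are their own `𝓛₋`-components, hence so is their derivative
  have h1 : minusPart G Lm (X * Y - Y * X) = X * Y - Y * X := by
    funext z
    have h2 := hasDerivAt_minusPart hG hL hγ.pos hW hmem' z
    have h3 := hW.hasDerivAt hγ.pos z
    rw [e] at h2 h3
    refine h2.unique (h3.congr_of_eventuallyEq ?_)
    filter_upwards [Ioo_mem_nhds_zero hγ.pos] with s hs
    rw [minusPart_eq hG hL ⟨hmem s hs, by rw [sub_self]; exact (plusSubmodule hG).zero_mem⟩]
  rw [← h1]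
  exact (isMinusPart_minusPart hL (e ▸ loopDeriv_mem_loopAlg hG hγ.pos hW hmem')).1

end MinusAlgebra

/-! ### The local action of circle diffeomorphisms -/

section Action

variable {A : Type*} [NormedRing A] [NormedAlgebra ℂ A] {G : Subgroup Aˣ} {ε r : ℝ}
  {C : Circle → Aˣ} {f g h : Circle → Aˣ} {k : ℝ → Equiv.Perm Circle}
  {Lm : Subgroup (Circle → Aˣ)} {ξ η : Circle → ℂ}

lemma one_mem_arc (hε : 0 < ε) : (1 : Circle) ∈ arc ε := ⟨0, by simpa using hε, by simp⟩

lemma arc_mem_nhds_one (hε : 0 < ε) : arc ε ∈ nhds (1 : Circle) := by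
  have h : ContinuousAt (fun z : Circle => |(z : ℂ).arg|) 1 := contMDiffAt_arg_one.continuousAt.abs
  filter_upwards [h.eventually_lt continuousAt_const (by simpa using hε)] with z hz
  exact ⟨_, hz, (Circle.exp_arg z).symm⟩

lemma IsLocalHom.map_one (hC : IsLocalHom G ε C) : C 1 = 1 := by
  have h1 := one_mem_arc hC.pos
  have := hC.mul 1 h1 1 h1 (by simpa using h1)
  simpa using this

lemma inDomain_one (hε : 0 < ε) : InDomain ε 1 := fun z => by simpa using one_mem_arc hε

lemma diamond_one (hC : IsLocalHom G ε C) : diamond C 1 f = f := by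
  funext z
  simp [diamond, hC.map_one]

/-- The cocycle identity of the action: `(k₁k₂) ⋄ f = (k₂ ⋄ f) ∘ k₁⁻¹ · C(k₁⁻¹(λ)/λ)`. -/
lemma diamond_mul (hC : IsLocalHom G ε C) {k₁ k₂ : Equiv.Perm Circle} (h₁ : InDomain ε k₁)
    (h₂ : InDomain ε k₂) (h₁₂ : InDomain ε (k₁ * k₂)) (z : Circle) :
    diamond C (k₁ * k₂) f z = diamond C k₂ f (k₁⁻¹ z) * C (k₁⁻¹ z / z) := by
  have e : k₂⁻¹ (k₁⁻¹ z) / z = k₂⁻¹ (k₁⁻¹ z) / k₁⁻¹ z * (k₁⁻¹ z / z) := by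
    rw [div_mul_div_cancel]
  have h3 : k₂⁻¹ (k₁⁻¹ z) / z ∈ arc ε := by simpa [mul_inv_rev] using h₁₂ z
  rw [e] at h3
  simp only [diamond, mul_inv_rev, Equiv.Perm.coe_mul, Function.comp_apply]
  rw [e, hC.mul _ (h₂ _) _ (h₁ z) h3, mul_assoc]

lemma exists_inDomain (hε : 0 < ε) (hk : IsDiffeoCurve r k) :
    ∃ r' > 0, r' ≤ r ∧ ∀ s ∈ Ioo (-r') r', InDomain ε (k s) := by
  have hev : ∀ᶠ s in nhds (0 : ℝ), ∀ z ∈ (univ : Set Circle), (k s)⁻¹ z / z ∈ arc ε := by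
    apply isCompact_univ.eventually_forall_of_forall_eventually
    intro z _
    have h1 : ContinuousAt (fun p : ℝ × Circle => (k p.1)⁻¹ p.2) ((0 : ℝ), z) :=
      hk.smooth_inv.continuousOn.continuousAt
        (prod_mem_nhds (Ioo_mem_nhds_zero hk.pos) Filter.univ_mem)
    have h2 : ContinuousAt (fun p : ℝ × Circle => (k p.1)⁻¹ p.2 / p.2) ((0 : ℝ), z) :=
      h1.div' continuousAt_snd
    exact h2.eventually_mem (by simpa [hk.zero] using arc_mem_nhds_one hε)
  obtain ⟨δ, hδ, hball⟩ := Metric.eventually_nhds_iff.1 hev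
  refine ⟨min δ r, lt_min hδ hk.pos, min_le_right _ _, fun s hs z => hball ?_ z (mem_univ z)⟩
  rw [Real.dist_eq, sub_zero]
  exact (abs_lt.2 hs).trans_le (min_le_left _ _)

lemma hasDerivAt_localHom (hC : IsLocalHom G ε C) :
    HasDerivAt (fun t : ℝ => (C (Circle.exp t) : A)) (Complex.I • derivOne C) 0 := by
  have h1 : ContDiffOn ℝ ∞ (fun t : ℝ => (C (Circle.exp t) : A)) (Ioo (-ε) ε) :=
    (hC.smooth.comp contMDiff_circleExp.contMDiffOn
      (fun t ht => ⟨t, abs_lt.2 ht, rfl⟩)).contDiffOn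
  have h2 := ((h1.contDiffAt (Ioo_mem_nhds_zero hC.pos)).differentiableAt (by simp)).hasDerivAt
  refine h2.congr_deriv ?_
  simp only [derivOne, dLam, Circle.coe_one, mul_one, one_mul]
  rw [smul_inv_smul₀ Complex.I_ne_zero]

lemma virasoroSymbol_eq (j : ℤ) (hξ : ∀ z : Circle, ξ z + Complex.I * η z = (z : ℂ) ^ (j + 1)) :
    virasoroSymbol C j f = symbol C ξ f + Complex.I • symbol C η f := by
  funext z
  have hz := z.coe_ne_zero
  have e : (z : ℂ) ^ j = ξ z / z + Complex.I * (η z / z) := by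
    rw [mul_div_assoc', ← add_div, hξ, zpow_add_one₀ hz, mul_div_cancel_right₀ _ hz]
  simp only [virasoroSymbol, symbol, Pi.add_apply, Pi.smul_apply]
  rw [← hξ, e]
  module

variable [FiniteDimensional ℂ A]

lemma diamond_mem_loopGroup (hC : IsLocalHom G ε C) {k : Equiv.Perm Circle} (hk : k ∈ circleDiffeo)
    (hd : InDomain ε k) (hf : f ∈ loopGroup G) : diamond C k f ∈ loopGroup G := by
  refine ⟨?_, fun z => mul_mem (hf.2 _) (hC.mem _ (hd z))⟩
  have h1 : ContMDiff (𝓡 1) 𝓘(ℝ, A) ∞ (fun z => (f (k⁻¹ z) : A)) := hf.1.comp hk.2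
  have h2 : ContMDiff (𝓡 1) (𝓡 1) ∞ (fun z : Circle => k⁻¹ z / z) := hk.2.div contMDiff_id
  have h3 : ContMDiff (𝓡 1) 𝓘(ℝ, A) ∞ (fun z : Circle => (C (k⁻¹ z / z) : A)) :=
    hC.smooth.comp_contMDiff h2 hd
  exact (contDiff_mul (𝕜 := ℝ) (𝔸 := A)).comp_contMDiff (h1.prodMk_space h3)

lemma smoothCurve_diamond (hC : IsLocalHom G ε C) (hk : IsDiffeoCurve r k)
    (hd : ∀ s ∈ Ioo (-r) r, InDomain ε (k s)) (hf : f ∈ loopGroup G) :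
    SmoothCurve r (fun s => diamond C (k s) f) := by
  have h1 : ContMDiffOn (𝓘(ℝ, ℝ).prod (𝓡 1)) 𝓘(ℝ, A) ∞
      (fun p : ℝ × Circle => (f ((k p.1)⁻¹ p.2) : A)) (Ioo (-r) r ×ˢ univ) :=
    hf.1.comp_contMDiffOn hk.smooth_inv
  have h2 : ContMDiffOn (𝓘(ℝ, ℝ).prod (𝓡 1)) (𝓡 1) ∞
      (fun p : ℝ × Circle => (k p.1)⁻¹ p.2 / p.2) (Ioo (-r) r ×ˢ univ) :=
    hk.smooth_inv.div contMDiffOn_snd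
  have h3 : ContMDiffOn (𝓘(ℝ, ℝ).prod (𝓡 1)) 𝓘(ℝ, A) ∞
      (fun p : ℝ × Circle => (C ((k p.1)⁻¹ p.2 / p.2) : A)) (Ioo (-r) r ×ˢ univ) :=
    hC.smooth.comp h2 (fun p hp => hd p.1 hp.1 p.2)
  exact (contDiff_mul (𝕜 := ℝ) (𝔸 := A)).contMDiff.comp_contMDiffOn (h1.prodMk_space h3)

lemma IsSharp.unique (hL : IsSplitting G Lm) {k : Equiv.Perm Circle}
    (hg : IsSharp G Lm ε C k f g) (hh : IsSharp G Lm ε C k f h) : g = h := by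
  obtain ⟨-, hgm, gp, hgp, e⟩ := hg
  obtain ⟨-, hhm, hp, hhp, e'⟩ := hh
  have h1 : hp⁻¹ * gp = h * g⁻¹ := by
    rw [e] at e'
    rw [inv_mul_eq_iff_eq_mul, ← mul_assoc, ← e', mul_inv_cancel_right]
  have h2 : h * g⁻¹ ∈ plusGroup G ⊓ Lm :=
    ⟨h1 ▸ (plusGroup G).mul_mem ((plusGroup G).inv_mem hhp) hgp, Lm.mul_mem hhm (Lm.inv_mem hgm)⟩
  rw [hL.inf_eq, Subgroup.mem_bot, mul_inv_eq_one] at h2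
  exact h2.symm

lemma isSharp_one (hC : IsLocalHom G ε C) (hf : f ∈ Lm) : IsSharp G Lm ε C 1 f f :=
  ⟨inDomain_one hC.pos, hf, 1, one_mem _, by rw [diamond_one hC, one_mul]⟩

/-- `L₊` is invariant under the diffeomorphisms that extend to the disc. -/
lemma comp_mem_plusGroup {k : Equiv.Perm Circle} (hk : k ∈ DPlus) (hf : f ∈ plusGroup G) :
    (fun z => f (k z)) ∈ plusGroup G := by
  obtain ⟨hf, F, hF, hFG, hFe⟩ := hf
  obtain ⟨hkd, ⟨K, hK, hKm, hKe⟩, -⟩ := hk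
  refine ⟨⟨hf.1.comp hkd.1, fun z => hf.2 _⟩, F ∘ K, hF.comp hK hKm, fun z hz => hFG _ ?_,
    fun z => by simp [hKe, hFe]⟩
  rcases (mem_closedBall_zero_iff.1 hz).lt_or_eq with h | h
  · exact ball_subset_closedBall (hKm (mem_ball_zero_iff.2 h))
  · have e := hKe ⟨z, mem_sphere_zero_iff_norm.2 h⟩
    change K z = _ at e
    simp [e, Circle.norm_coe]

lemma isSharp_mul_iff (hC : IsLocalHom G ε C) {k₁ k₂ : Equiv.Perm Circle} (hk₁ : k₁ ∈ DPlus)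
    (h₁ : InDomain ε k₁) (h₁₂ : InDomain ε (k₁ * k₂)) (hg : IsSharp G Lm ε C k₂ f g) :
    IsSharp G Lm ε C (k₁ * k₂) f h ↔ IsSharp G Lm ε C k₁ g h := by
  obtain ⟨h₂, hgm, gp, hgp, e⟩ := hg
  have hq : (fun z => gp (k₁⁻¹ z)) ∈ plusGroup G := comp_mem_plusGroup (inv_mem hk₁) hgp
  have key : diamond C (k₁ * k₂) f = (fun z => gp (k₁⁻¹ z)) * diamond C k₁ g := by
    funext z
    rw [diamond_mul hC h₁ h₂ h₁₂, e]
    simp [diamond, mul_assoc]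
  constructor
  · rintro ⟨-, hh, p, hp, ep⟩
    refine ⟨h₁, hh, (fun z => gp (k₁⁻¹ z))⁻¹ * p, mul_mem (inv_mem hq) hp, ?_⟩
    rw [mul_assoc, ← ep, key, inv_mul_cancel_left]
  · rintro ⟨-, hh, p, hp, ep⟩
    exact ⟨h₁₂, hh, _, mul_mem hq hp, by rw [key, ep, mul_assoc]⟩

lemma isCurveIn_diamond (hC : IsLocalHom G ε C) (hk : IsDiffeoCurve r k)
    (hd : ∀ s ∈ Ioo (-r) r, InDomain ε (k s)) (hf : f ∈ loopGroup G) :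
    IsCurveIn (loopGroup G) r (fun s => diamond C (k s) f) f :=
  ⟨hk.pos, fun s hs => diamond_mem_loopGroup hC (hk.mem s hs) (hd s hs) hf,
    smoothCurve_diamond hC hk hd hf, by rw [hk.zero, diamond_one hC]⟩

/-- A factorization `(k_s ⋄ f) f⁻¹ = g₊ g₋` gives `k_s ♯ f = g₋ f`. -/
lemma exists_isSharp_curve (hL : IsSplitting G Lm) (hC : IsLocalHom G ε C)
    (hF : FactorsLocally G Lm) (hk : IsDiffeoCurve r k) (hf : f ∈ Lm) :
    ∃ r' g, r' ≤ r ∧ IsCurveIn Lm r' g f ∧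
      ∀ s ∈ Ioo (-r') r', IsSharp G Lm ε C (k s) f (g s) := by
  obtain ⟨r₁, hr₁, hr₁r, hd⟩ := exists_inDomain hC.pos hk
  have hk₁ : IsDiffeoCurve r₁ k := ⟨hr₁, fun s hs => hk.mem s (Ioo_subset_of_le hr₁r hs),
    hk.smooth.mono (prod_mono (Ioo_subset_of_le hr₁r) subset_rfl),
    hk.smooth_inv.mono (prod_mono (Ioo_subset_of_le hr₁r) subset_rfl), hk.zero⟩
  obtain ⟨r₂, gp, gm, hgp, hgm, e⟩ := hF r₁ _
    ((isCurveIn_diamond hC hk₁ hd (hL.le hf)).mul_inv_const le_rfl)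
  have hp := lt_min hr₁ hgm.pos
  refine ⟨min r₁ r₂, fun s => gm s * f, (min_le_left _ _).trans hr₁r, ?_, fun s hs => ?_⟩
  · simpa using (hgm.mono hp (min_le_right _ _)).mul (isCurveIn_const hp hf hL.le)
  · have hs₁ := Ioo_subset_of_le (min_le_left r₁ r₂) hs
    have hs₂ := Ioo_subset_of_le (min_le_right r₁ r₂) hs
    refine ⟨hd s hs₁, mul_mem (hgm.mem s hs₂) hf, gp s, hgp.mem s hs₂, ?_⟩
    rw [← mul_assoc, ← e s hs₂, inv_mul_cancel_right]

/-! ### The infinitesimal action -/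

/-- The angle `τ(s)` of `k_s⁻¹(λ)/λ` has velocity `-ξ(λ)/(iλ)`. It comes from differentiating
`k_s(λ e^{iτ(s)}) = λ`. -/
lemma exists_angle (hk : IsDiffeoCurve r k) (hξ : HasVelocity k ξ) (z : Circle) :
    ∃ (τ : ℝ → ℝ) (τ' : ℝ), HasDerivAt τ τ' 0 ∧ τ 0 = 0 ∧
      (∀ s, Circle.exp (τ s) = (k s)⁻¹ z / z) ∧ (τ' : ℂ) * (Complex.I * z) = -ξ z := by
  have h0 : Ioo (-r) r ×ˢ (univ : Set Circle) ∈ nhds ((0 : ℝ), z) :=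
    prod_mem_nhds (Ioo_mem_nhds_zero hk.pos) Filter.univ_mem
  have hone : (k 0)⁻¹ z / z = 1 := by simp [hk.zero]
  have h1 : ContMDiffAt 𝓘(ℝ, ℝ) (𝓡 1) ∞ (fun s : ℝ => (k s)⁻¹ z / z) 0 :=
    (ContMDiffAt.comp (g := fun p : ℝ × Circle => (k p.1)⁻¹ p.2) (f := fun s : ℝ => (s, z)) 0
      (hk.smooth_inv.contMDiffAt h0) (contMDiffAt_id.prodMk contMDiffAt_const)).div
      contMDiffAt_const
  have h2 : ContMDiffAt (𝓡 1) 𝓘(ℝ, ℝ) ∞ (fun w : Circle => (w : ℂ).arg) ((k 0)⁻¹ z / z) :=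
    hone ▸ contMDiffAt_arg_one
  have h3 : ContDiffAt ℝ ∞ (fun s : ℝ => (((k s)⁻¹ z / z : Circle) : ℂ).arg) 0 :=
    (ContMDiffAt.comp (g := fun w : Circle => (w : ℂ).arg) (f := fun s : ℝ => (k s)⁻¹ z / z) 0
      h2 h1).contDiffAt
  set τ : ℝ → ℝ := fun s => (((k s)⁻¹ z / z : Circle) : ℂ).arg with hτ
  have hτ0 : τ 0 = 0 := by simp only [hτ, hone]; simp
  have hexp : ∀ s, Circle.exp (τ s) = (k s)⁻¹ z / z := fun s => Circle.exp_arg _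
  have hτ' := (h3.differentiableAt (by simp)).hasDerivAt
  refine ⟨τ, deriv τ 0, hτ', hτ0, hexp, ?_⟩
  have h4 : ContMDiffAt 𝓘(ℝ, ℝ × ℝ) (𝓘(ℝ, ℝ).prod (𝓡 1)) ∞
      (fun p : ℝ × ℝ => (p.1, z * Circle.exp p.2)) (0, 0) :=
    (contDiff_fst.contMDiff.prodMk (contMDiff_const.mul
      (contMDiff_circleExp.comp contDiff_snd.contMDiff))) _
  have h5 : ContMDiffAt (𝓘(ℝ, ℝ).prod (𝓡 1)) (𝓡 1) ∞ (fun p : ℝ × Circle => k p.1 p.2)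
      ((0 : ℝ), z * Circle.exp 0) :=
    hk.smooth.contMDiffAt (by simpa using h0)
  have h6 : ContMDiffAt 𝓘(ℝ, ℝ × ℝ) (𝓡 1) ∞ (fun p : ℝ × ℝ => k p.1 (z * Circle.exp p.2)) (0, 0) :=
    ContMDiffAt.comp (g := fun p : ℝ × Circle => k p.1 p.2)
      (f := fun p : ℝ × ℝ => (p.1, z * Circle.exp p.2)) (0, 0) h5 h4
  have h7 : ContDiffAt ℝ ∞ (fun p : ℝ × ℝ => (k p.1 (z * Circle.exp p.2) : ℂ)) (0, 0) :=
    (contMDiff_circle_coe.contMDiffAt.comp (0, 0) h6).contDiffAt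
  have h8 := (h7.differentiableAt (by simp)).hasFDerivAt
  set L := fderiv ℝ (fun p : ℝ × ℝ => (k p.1 (z * Circle.exp p.2) : ℂ)) (0, 0) with hL
  have hs : L (1, 0) = ξ z := by
    have h9 := HasFDerivAt.comp_hasDerivAt (f := fun s : ℝ => (s, (0 : ℝ))) (0 : ℝ) h8
      ((hasDerivAt_id (0 : ℝ)).prodMk (hasDerivAt_const (0 : ℝ) (0 : ℝ)))
    refine h9.unique ?_
    simpa [Function.comp_def] using hξ z
  have ht : L (0, 1) = Complex.I * z := by
    have h9 := HasFDerivAt.comp_hasDerivAt (f := fun t : ℝ => ((0 : ℝ), t)) (0 : ℝ) h8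
      ((hasDerivAt_const (0 : ℝ) (0 : ℝ)).prodMk (hasDerivAt_id (0 : ℝ)))
    refine h9.unique ?_
    simpa [Function.comp_def, hk.zero] using hasDerivAt_coe_rotate z
  have h8' : HasFDerivAt (fun p : ℝ × ℝ => (k p.1 (z * Circle.exp p.2) : ℂ)) L
      ((fun s : ℝ => (s, τ s)) 0) := by simpa [hτ0] using h8
  have h10 := h8'.comp_hasDerivAt (0 : ℝ) ((hasDerivAt_id (0 : ℝ)).prodMk hτ')
  -- `k_s(λ e^{iτ(s)}) = λ` does not depend on `s`
  have h11 : L (1, deriv τ 0) = 0 := by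
    refine h10.unique ?_
    have e : ((fun p : ℝ × ℝ => (k p.1 (z * Circle.exp p.2) : ℂ)) ∘ fun s : ℝ => (id s, τ s)) =
        fun _ => (z : ℂ) := by
      funext s
      simp [hexp]
    rw [e]
    exact hasDerivAt_const _ _
  have h12 : ((1 : ℝ), deriv τ 0) = (1, 0) + deriv τ 0 • ((0 : ℝ), (1 : ℝ)) := by simp
  rw [h12, map_add, map_smul, hs, ht, Complex.real_smul] at h11
  linear_combination h11

lemma hasLoopVelocity_diamond (hC : IsLocalHom G ε C) (hk : IsDiffeoCurve r k)
    (hξ : HasVelocity k ξ) (hf : f ∈ loopGroup G) :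
    HasLoopVelocity (fun s => diamond C (k s) f) (fun z => -(symbol C ξ f z * f z)) := by
  intro z
  obtain ⟨τ, τ', hτ, hτ0, hexp, hτ'⟩ := exists_angle hk hξ z
  have h1 := hasDerivAt_mul_fun (hasDerivAt_rotate hf.1 z) (hasDerivAt_localHom hC)
  rw [← hτ0] at h1
  have h2 := h1.scomp (0 : ℝ) hτ
  have e : ((fun x : ℝ => (f (z * Circle.exp x) : A) * (C (Circle.exp x) : A)) ∘ τ) =
      fun s => (diamond C (k s) f z : A) := by
    funext s
    simp [hexp, diamond]
  rw [e] at h2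
  refine h2.congr_deriv ?_
  have hz := z.coe_ne_zero
  have e2 : (τ' : ℂ) * Complex.I = -(ξ z / z) := by
    field_simp
    linear_combination hτ'
  simp only [hτ0, Circle.exp_zero, mul_one, hC.map_one, Units.val_one, symbol]
  rw [← Complex.coe_smul, smul_add, smul_smul, mul_smul_comm, smul_smul, hτ', e2, add_mul,
    smul_mul_assoc, smul_mul_assoc, Units.inv_mul_cancel_right, Units.inv_mul_cancel_right,
    neg_smul, neg_smul, neg_add]

/-- The infinitesimal action: `(k_s ⋄ f) g_s⁻¹` is a curve in `L₊`, so the velocity of `g_s`,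
translated to the identity, is the `𝓛₋`-component of the velocity of `(k_s ⋄ f) f⁻¹`. -/
lemma isMinusPart_symbol (hG : IsComplexLieGroup G) (hL : IsSplitting G Lm)
    (hC : IsLocalHom G ε C) (hk : IsDiffeoCurve r k) (hξ : HasVelocity k ξ) (hf : f ∈ Lm)
    {g : ℝ → Circle → Aˣ} (hg : ∀ s ∈ Ioo (-r) r, IsSharp G Lm ε C (k s) f (g s))
    (hgs : SmoothCurve r g) {g' : Circle → A} (hg' : HasLoopVelocity g g') :
    symbol C ξ f ∈ loopAlg G ∧
      IsMinusPart G Lm (symbol C ξ f) (-fun z => g' z * ((f z)⁻¹ : Aˣ)) := by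
  have hfl := hL.le hf
  have hD := isCurveIn_diamond hC hk (fun s hs => (hg s hs).1) hfl
  have hDv := hasLoopVelocity_diamond hC hk hξ hfl
  have hg0 : g 0 = f := (hk.zero ▸ hg 0 (zero_mem_Ioo hk.pos)).unique hL (isSharp_one hC hf)
  have hgc : IsCurveIn Lm r g f := ⟨hk.pos, fun s hs => (hg s hs).2.1, hgs, hg0⟩
  have h1 : HasLoopVelocity (fun s => diamond C (k s) f * f⁻¹) (-symbol C ξ f) := fun z => by
    have := (hDv z).mul_const (((f z)⁻¹ : Aˣ) : A)
    simpa using this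
  have h2 := velocity_mem_loopAlg (hD.mul_inv_const le_rfl)
  rw [h1.eq_loopDeriv] at h2
  -- the factor `g₊` of `k_s ⋄ f`
  have hP : IsCurveIn (plusGroup G) r (fun s => diamond C (k s) f * (g s)⁻¹) 1 := by
    refine ⟨hk.pos, fun s hs => ?_, SmoothCurve.mul hD.smooth (SmoothCurve.inv hgs), ?_⟩
    · obtain ⟨-, -, gp, hgp, e⟩ := hg s hs
      simpa [e] using hgp
    · simp [hg0, hk.zero, diamond_one hC]
  have h3 : HasLoopVelocity (fun s => diamond C (k s) f * (g s)⁻¹)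
      (-(symbol C ξ f - -fun z => g' z * ((f z)⁻¹ : Aˣ))) := fun z => by
    have := hasDerivAt_mul_fun (hDv z) (HasDerivAt.units_inv (hg' z))
    refine this.congr_deriv ?_
    simp [hg0, hk.zero, diamond_one hC, mul_assoc, sub_eq_add_neg, add_comm]
  have h4 := velocity_mem_plusAlg hP
  rw [h3.eq_loopDeriv] at h4
  refine ⟨(loopSubmodule hG).neg_mem_iff.1 h2,
    (minusSubmodule hL.le).neg_mem (velocity_mul_inv_mem hL.le hgc hg'), ?_⟩
  exact (plusSubmodule hG).neg_mem_iff.1 h4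

lemma hasLoopVelocity_sharp (hG : IsComplexLieGroup G) (hL : IsSplitting G Lm)
    (hC : IsLocalHom G ε C) (hk : IsDiffeoCurve r k) (hξ : HasVelocity k ξ) (hf : f ∈ Lm)
    {g : ℝ → Circle → Aˣ} (hg : ∀ s ∈ Ioo (-r) r, IsSharp G Lm ε C (k s) f (g s))
    (hgs : SmoothCurve r g) :
    symbol C ξ f ∈ loopAlg G ∧
      HasLoopVelocity g (fun z => -(minusPart G Lm (symbol C ξ f) z) * (f z : A)) := by
  have hv : HasLoopVelocity g (loopDeriv fun s z => (g s z : A)) :=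
    (smoothCurve_iff.1 hgs).hasDerivAt hk.pos
  obtain ⟨h1, h2⟩ := isMinusPart_symbol hG hL hC hk hξ hf hg hgs hv
  refine ⟨h1, fun z => ?_⟩
  rw [minusPart_eq hG hL h2]
  simpa using hv z

/-- The infinitesimal action of a complex vector field `ξ + iη`. -/
lemma virasoroField_eq (hG : IsComplexLieGroup G) (hL : IsSplitting G Lm)
    (hC : IsLocalHom G ε C) {l : ℝ → Equiv.Perm Circle} (j : ℤ)
    (hk : IsDiffeoCurve r k) (hξ : HasVelocity k ξ) (hl : IsDiffeoCurve r l) (hη : HasVelocity l η)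
    (hj : ∀ z : Circle, ξ z + Complex.I * η z = (z : ℂ) ^ (j + 1)) (hf : f ∈ Lm)
    {g h : ℝ → Circle → Aˣ} (hg : ∀ s ∈ Ioo (-r) r, IsSharp G Lm ε C (k s) f (g s))
    (hgs : SmoothCurve r g) (hh : ∀ s ∈ Ioo (-r) r, IsSharp G Lm ε C (l s) f (h s))
    (hhs : SmoothCurve r h) {g' h' : Circle → A} (hg' : HasLoopVelocity g g')
    (hh' : HasLoopVelocity h h') (z : Circle) :
    virasoroField G Lm C j f z =
      g' z + minusPart G Lm (fun w => Complex.I • (h' w * ((f w)⁻¹ : Aˣ))) z * (f z : A) := by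
  obtain ⟨-, h1⟩ := isMinusPart_symbol hG hL hC hk hξ hf hg hgs hg'
  obtain ⟨-, h2⟩ := isMinusPart_symbol hG hL hC hl hη hf hh hhs hh'
  set H : Circle → A := fun w => h' w * ((f w)⁻¹ : Aˣ) with hH
  have hHm : H ∈ loopLieAlg Lm := (minusSubmodule hL.le).neg_mem_iff.1 h2.1
  have h3 : IsMinusPart G Lm (Complex.I • H) (minusPart G Lm (Complex.I • H)) :=
    isMinusPart_minusPart hL ((loopSubmodule hG).smul_mem _ (loopLieAlg_subset_loopAlg hL.le hHm))
  -- `𝓛₊` is complex, so `i` times the symbol and `i` times its `𝓛₋`-component agree modulo `𝓛₊`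
  have h4 : IsMinusPart G Lm (Complex.I • symbol C η f) (-minusPart G Lm (Complex.I • H)) := by
    refine ⟨(minusSubmodule hL.le).neg_mem h3.1, ?_⟩
    have h5 := (plusSubmodule hG).sub_mem ((plusSubmodule hG).smul_mem Complex.I h2.2) h3.2
    have e : Complex.I • (symbol C η f - -H) - (Complex.I • H - minusPart G Lm (Complex.I • H)) =
        Complex.I • symbol C η f - -minusPart G Lm (Complex.I • H) := by module
    rwa [e] at h5
  have h6 := minusPart_eq hG hL (h1.add hG hL h4)
  rw [virasoroField, virasoroSymbol_eq j hj, h6]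
  change -((-(g' z * ((f z)⁻¹ : Aˣ))) + -minusPart G Lm (Complex.I • H) z) * (f z : A) = _
  rw [neg_add, neg_neg, neg_neg, add_mul, Units.inv_mul_cancel_right]
  rfl

end Action

/-! ### The Virasoro action -/

section Virasoro

variable {A : Type*} [NormedRing A] [NormedAlgebra ℂ A] {G : Subgroup Aˣ}
  {ε r : ℝ} {C : Circle → Aˣ} {f : Circle → Aˣ} {Lm : Subgroup (Circle → Aˣ)}

lemma derivOne_mem_lieAlg (hG : IsComplexLieGroup G) (hC : IsLocalHom G ε C) :
    derivOne C ∈ lieAlg G := by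
  have h1 : ContDiffOn ℝ ∞ (fun t : ℝ => (C (Circle.exp t) : A)) (Ioo (-ε) ε) :=
    (hC.smooth.comp contMDiff_circleExp.contMDiffOn
      (fun t ht => ⟨t, abs_lt.2 ht, rfl⟩)).contDiffOn
  have h2 := mul_inv_mem_lieAlg (γ := fun t => C (Circle.exp t)) hC.pos
    (fun t ht => hC.mem _ ⟨t, abs_lt.2 ht, rfl⟩) h1 (hasDerivAt_localHom hC)
  simp only [Circle.exp_zero, hC.map_one, inv_one, Units.val_one, mul_one] at h2
  have h3 := (lieSubmodule hG).smul_mem Complex.I⁻¹ h2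
  rwa [inv_smul_smul₀ Complex.I_ne_zero] at h3

lemma virasoroSymbol_eq_zpow_smul (j : ℤ) :
    virasoroSymbol C j f = fun z : Circle => (z : ℂ) ^ (j + 1) • virasoroSymbol C (-1) f z := by
  funext z
  simp only [virasoroSymbol, smul_add, smul_smul]
  rw [neg_add_cancel, zpow_zero, mul_one, zpow_add_one₀ z.coe_ne_zero, zpow_neg_one,
    mul_inv_cancel_right₀ z.coe_ne_zero]

lemma virasoroSymbol_commute (j k : ℤ) :
    virasoroSymbol C j f * virasoroSymbol C k f = virasoroSymbol C k f * virasoroSymbol C j f := by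
  rw [virasoroSymbol_eq_zpow_smul j, virasoroSymbol_eq_zpow_smul k]
  funext z
  simp only [Pi.mul_apply, smul_mul_smul_comm]
  rw [mul_comm]

lemma IsMinusPart.of_sub_mem {X X' Y : Circle → A} (hG : IsComplexLieGroup G)
    (h : IsMinusPart G Lm X Y) (h' : X' - X ∈ plusAlg G) : IsMinusPart G Lm X' Y :=
  ⟨h.1, by simpa only [sub_add_sub_cancel] using! (plusSubmodule hG).add_mem h' h.2⟩

variable [FiniteDimensional ℂ A]

lemma virasoroSymbol_mem_loopAlg (hG : IsComplexLieGroup G) (hC : IsLocalHom G ε C) (j : ℤ)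
    (hf : f ∈ loopGroup G) : virasoroSymbol C j f ∈ loopAlg G :=
  (loopSubmodule hG).add_mem (zpow_smul_mem_loopAlg hG (j + 1) (dLam_mul_inv_mem_loopAlg hG hf))
    (zpow_smul_mem_loopAlg hG j (conj_mem_loopAlg hf
      (X := fun _ => derivOne C) ⟨contMDiff_const, fun _ => derivOne_mem_lieAlg hG hC⟩))

lemma isTangentField_virasoroField (hG : IsComplexLieGroup G) (hL : IsSplitting G Lm)
    (hC : IsLocalHom G ε C) (j : ℤ) : IsTangentField Lm (virasoroField G Lm C j) := by
  intro f hf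
  have h1 := isMinusPart_minusPart hL (virasoroSymbol_mem_loopAlg hG hC j (hL.le hf))
  have h2 := (minusSubmodule hL.le).neg_mem h1.1
  have e : (fun z => virasoroField G Lm C j f z * ((f z)⁻¹ : Aˣ)) =
      -minusPart G Lm (virasoroSymbol C j f) := by
    funext z
    simp [virasoroField]
  rw [e]
  exact h2

/-- Along a curve with velocity `-P f`, the symbol `S_k` of `Z_k` varies by
`-λ^{k+1} P_λ - [P, S_k(f)]`. -/
lemma loopDeriv_virasoroSymbol {γ : ℝ → Circle → Aˣ} (hγ : IsCurveIn (loopGroup G) r γ f)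
    {P : Circle → A} (hP : ContMDiff (𝓡 1) 𝓘(ℝ, A) ∞ P)
    (hv : HasLoopVelocity γ (fun z => -(P z) * (f z : A))) (k : ℤ) :
    loopDeriv (fun s => virasoroSymbol C k (γ s)) =
      -(fun z : Circle => (z : ℂ) ^ (k + 1) • dLam P z) -
        (P * virasoroSymbol C k f - virasoroSymbol C k f * P) := by
  have hsm := smoothCurve_iff.1 hγ.smooth
  have hfs : ContMDiff (𝓡 1) 𝓘(ℝ, A) ∞ (fun z => (f z : A)) := by
    simpa [hγ.zero] using hsm.contMDiff_apply (zero_mem_Ioo hγ.pos)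
  funext z
  have hd : dLam (fun z => -(P z) * (f z : A)) z =
      -(dLam P z * (f z : A) + P z * dLam (fun w => (f w : A)) z) := by
    apply dLam_eq_of_hasDerivAt
    have h1 := (hasDerivAt_mul_fun (hasDerivAt_rotate hP z) (hasDerivAt_rotate hfs z)).neg
    refine (h1.congr_of_eventuallyEq (Filter.Eventually.of_forall fun t => ?_)).congr_deriv ?_
    · simp
    · simp [smul_add]
  have h1 := hsm.hasDerivAt_dLam hγ.pos z
  rw [hv.eq_loopDeriv, hd] at h1
  have h2 := HasDerivAt.units_inv (hv z)
  have h3 := (hasDerivAt_mul_fun h1 h2).const_smul ((z : ℂ) ^ (k + 1))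
  have h4 := (hasDerivAt_mul_fun ((hv z).mul_const (derivOne C)) h2).const_smul ((z : ℂ) ^ k)
  have h5 := (h3.add h4).deriv
  refine h5.trans ?_
  simp only [hγ.zero, virasoroSymbol, Pi.sub_apply, Pi.neg_apply, Pi.mul_apply, neg_mul, mul_neg,
    neg_neg, mul_add, add_mul, mul_assoc, Units.mul_inv, mul_one, mul_smul_comm, smul_mul_assoc]
  module

/-- The directional derivative of `Z_k` along a curve in `L₋` with velocity `-P f`. -/
lemma hasDerivAt_virasoroField (hG : IsComplexLieGroup G) (hL : IsSplitting G Lm)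
    (hC : IsLocalHom G ε C) {γ : ℝ → Circle → Aˣ} (hγ : IsCurveIn Lm r γ f) {P : Circle → A}
    (hP : ContMDiff (𝓡 1) 𝓘(ℝ, A) ∞ P) (hv : HasLoopVelocity γ (fun z => -(P z) * (f z : A)))
    (k : ℤ) (z : Circle) :
    HasDerivAt (fun s => virasoroField G Lm C k (γ s) z)
      (-(minusPart G Lm (-(fun z : Circle => (z : ℂ) ^ (k + 1) • dLam P z) -
        (P * virasoroSymbol C k f - virasoroSymbol C k f * P)) z) * (f z : A) +
        minusPart G Lm (virasoroSymbol C k f) z * P z * (f z : A)) 0 := by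
  have hsm := smoothCurve_iff.1 hγ.smooth
  have hγ' : IsCurveIn (loopGroup G) r γ f :=
    ⟨hγ.pos, fun s hs => hL.le (hγ.mem s hs), hγ.smooth, hγ.zero⟩
  have hW : SmoothFamily r (fun s => virasoroSymbol C k (γ s)) :=
    ((hsm.dLam.mul hsm.units_inv).zpow_smul (k + 1)).add
      (((hsm.mul (smoothFamily_const (X := fun _ => derivOne C) contMDiff_const)).mul
        hsm.units_inv).zpow_smul k)
  have h1 := hasDerivAt_minusPart hG hL hγ.pos hW
    (fun s hs => virasoroSymbol_mem_loopAlg hG hC k (hγ'.mem s hs)) z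
  rw [loopDeriv_virasoroSymbol hγ' hP hv] at h1
  refine (hasDerivAt_mul_fun h1.neg (hv z)).congr_deriv ?_
  simp [hγ.zero, mul_assoc]

/-- The symbols `X = S_j(f)`, `Y = S_k(f)` commute and satisfy
`λ^{j+1} Y_λ - λ^{k+1} X_λ = (k - j) S_{j+k}(f)`: the Witt relation, since
`S_j = λ^{j+1} S_{-1}`. -/
lemma zpow_smul_dLam_virasoroSymbol (hG : IsComplexLieGroup G) (hC : IsLocalHom G ε C)
    (hf : f ∈ loopGroup G) (j k : ℤ) (z : Circle) :
    (z : ℂ) ^ (j + 1) • dLam (virasoroSymbol C k f) z -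
      (z : ℂ) ^ (k + 1) • dLam (virasoroSymbol C j f) z =
      ((k - j : ℤ) : ℂ) • virasoroSymbol C (j + k) f z := by
  have hU := (virasoroSymbol_mem_loopAlg hG hC (-1) hf).1
  have hz := z.coe_ne_zero
  rw [virasoroSymbol_eq_zpow_smul j, virasoroSymbol_eq_zpow_smul k,
    virasoroSymbol_eq_zpow_smul (j + k), dLam_zpow_smul _ hU, dLam_zpow_smul _ hU]
  have e1 : (z : ℂ) ^ (j + 1) * (z : ℂ) ^ (k + 1 - 1) = (z : ℂ) ^ (j + k + 1) := by
    rw [← zpow_add₀ hz]; congr 1; ring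
  have e2 : (z : ℂ) ^ (k + 1) * (z : ℂ) ^ (j + 1 - 1) = (z : ℂ) ^ (j + k + 1) := by
    rw [← zpow_add₀ hz]; congr 1; ring
  set U := virasoroSymbol C (-1) f z
  set D := dLam (virasoroSymbol C (-1) f) z
  calc _ = (((k + 1 : ℤ) : ℂ) * ((z : ℂ) ^ (j + 1) * (z : ℂ) ^ (k + 1 - 1)) -
        ((j + 1 : ℤ) : ℂ) * ((z : ℂ) ^ (k + 1) * (z : ℂ) ^ (j + 1 - 1))) • U := by module
    _ = ((k - j : ℤ) : ℂ) • ((z : ℂ) ^ (j + k + 1) • U) := by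
      rw [e1, e2, ← sub_mul, mul_smul]
      congr 1
      push_cast
      ring

theorem isLieBracket_virasoroField (hG : IsComplexLieGroup G) (hL : IsSplitting G Lm)
    (hC : IsLocalHom G ε C) {j k : ℤ} (hj : -1 ≤ j) (hk : -1 ≤ k) :
    IsLieBracket Lm (virasoroField G Lm C j) (virasoroField G Lm C k)
      (fun f z => ((k - j : ℤ) : ℂ) • virasoroField G Lm C (j + k) f z) := by
  intro f hf r γ δ hγ hγv hδ hδv z
  have hfl := hL.le hf
  set X := virasoroSymbol C j f with hXdef
  set Y := virasoroSymbol C k f with hYdef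
  have hX : X ∈ loopAlg G := virasoroSymbol_mem_loopAlg hG hC j hfl
  have hY : Y ∈ loopAlg G := virasoroSymbol_mem_loopAlg hG hC k hfl
  have hP := isMinusPart_minusPart hL hX
  have hQ := isMinusPart_minusPart hL hY
  set P := minusPart G Lm X with hPdef
  set Q := minusPart G Lm Y with hQdef
  have hPl := loopLieAlg_subset_loopAlg hL.le hP.1
  have hQl := loopLieAlg_subset_loopAlg hL.le hQ.1
  refine ⟨_, _, hasDerivAt_virasoroField hG hL hC hγ hPl.1 hγv k z,
    hasDerivAt_virasoroField hG hL hC hδ hQl.1 hδv j z, ?_⟩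
  rw [← hXdef, ← hYdef, ← hPdef, ← hQdef]
  have memL : ∀ (n : ℤ) {R S : Circle → A}, R ∈ loopAlg G → S ∈ loopAlg G →
      -(fun z : Circle => (z : ℂ) ^ n • dLam R z) - (R * S - S * R) ∈ loopAlg G :=
    fun n R S hR hS => (loopSubmodule hG).sub_mem ((loopSubmodule hG).neg_mem
      (zpow_smul_mem_loopAlg hG n (dLam_mem_loopAlg hG hR))) (bracket_mem_loopAlg hG hR hS)
  have hL1 := isMinusPart_minusPart hL (memL (k + 1) hPl hY)
  have hL2 := isMinusPart_minusPart hL (memL (j + 1) hQl hX)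
  set L₁ := -(fun z : Circle => (z : ℂ) ^ (k + 1) • dLam P z) - (P * Y - Y * P) with hL₁
  set L₂ := -(fun z : Circle => (z : ℂ) ^ (j + 1) • dLam Q z) - (Q * X - X * Q) with hL₂
  have hB : IsMinusPart G Lm (P * Q - Q * P) (P * Q - Q * P) :=
    ⟨bracket_mem_loopLieAlg hG hL hP.1 hQ.1, by
      rw [sub_self]; exact (plusSubmodule hG).zero_mem⟩
  have h1 := (hL1.sub hG hL hL2).add hG hL hB
  -- modulo `𝓛₊`, the variation of the symbols is the Witt bracket
  have h2 : ((k - j : ℤ) : ℝ) • virasoroSymbol C (j + k) f - (L₁ - L₂ + (P * Q - Q * P)) =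
      (fun z : Circle => (z : ℂ) ^ (j + 1) • dLam (Y - Q) z) -
        (fun z : Circle => (z : ℂ) ^ (k + 1) • dLam (X - P) z) -
        ((X - P) * (Y - Q) - (Y - Q) * (X - P)) := by
    have hcomm : X * Y = Y * X := virasoroSymbol_commute j k
    have h3 : ((k - j : ℤ) : ℝ) • virasoroSymbol C (j + k) f =
        (fun z : Circle => (z : ℂ) ^ (j + 1) • dLam Y z) -
          (fun z : Circle => (z : ℂ) ^ (k + 1) • dLam X z) := by
      funext w
      rw [Pi.sub_apply, zpow_smul_dLam_virasoroSymbol hG hC hfl j k w, Pi.smul_apply,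
        ← Complex.coe_smul, Complex.ofReal_intCast]
    have h4 : (fun z : Circle => (z : ℂ) ^ (j + 1) • dLam (Y - Q) z) =
        (fun z : Circle => (z : ℂ) ^ (j + 1) • dLam Y z) -
          (fun z : Circle => (z : ℂ) ^ (j + 1) • dLam Q z) := by
      funext w
      rw [dLam_sub hY.1 hQl.1, smul_sub]
      rfl
    have h5 : (fun z : Circle => (z : ℂ) ^ (k + 1) • dLam (X - P) z) =
        (fun z : Circle => (z : ℂ) ^ (k + 1) • dLam X z) -
          (fun z : Circle => (z : ℂ) ^ (k + 1) • dLam P z) := by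
      funext w
      rw [dLam_sub hX.1 hPl.1, smul_sub]
      rfl
    rw [h3, h4, h5, hL₁, hL₂]
    have h6 : (X - P) * (Y - Q) - (Y - Q) * (X - P) =
        (X * Y - Y * X) - (P * Y - Y * P) + (Q * X - X * Q) + (P * Q - Q * P) := by
      noncomm_ring
    rw [h6, hcomm]
    abel
  have h3 : ((k - j : ℤ) : ℝ) • virasoroSymbol C (j + k) f - (L₁ - L₂ + (P * Q - Q * P)) ∈
      plusAlg G := by
    rw [h2]
    exact (plusSubmodule hG).sub_mem ((plusSubmodule hG).sub_mem
      (pow_smul_mem_plusAlg hG (by omega) (dLam_mem_plusAlg hG hQ.2))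
      (pow_smul_mem_plusAlg hG (by omega) (dLam_mem_plusAlg hG hP.2)))
      (bracket_mem_plusAlg hG hP.2 hQ.2)
  have h4 := minusPart_eq hG hL (h1.of_sub_mem hG h3)
  rw [minusPart_eq hG hL ((isMinusPart_minusPart hL
    (virasoroSymbol_mem_loopAlg hG hC (j + k) hfl)).smul hG hL _)] at h4
  have h5 := congrFun h4 z
  simp only [Pi.smul_apply, Pi.add_apply, Pi.sub_apply, Pi.mul_apply] at h5
  rw [← Complex.coe_smul, Complex.ofReal_intCast] at h5
  simp only [virasoroField]
  rw [neg_mul, smul_neg, ← smul_mul_assoc, h5]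
  noncomm_ring

end Virasoro

end LoopVirasoro

open LoopVirasoro in
theorem theorem5p2 {A : Type*} [NormedRing A] [NormedAlgebra ℂ A] [FiniteDimensional ℂ A]
    (G : Subgroup Aˣ) (hG : IsComplexLieGroup G)
    (Lm : Subgroup (Circle → Aˣ)) (hL : IsSplitting G Lm)
    (ε : ℝ) (C : Circle → Aˣ) (hC : IsLocalHom G ε C) :
    -- `k ⋄ f` is a smooth loop in `G`, and its `L₋` factor is unique
    (∀ k ∈ DPlus, InDomain ε k → ∀ f ∈ Lm, diamond C k f ∈ loopGroup G) ∧
    (∀ k ∈ DPlus, ∀ f ∈ Lm, ∀ g h, IsSharp G Lm ε C k f g → IsSharp G Lm ε C k f h → g = h) ∧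
    -- `♯` is a (local) action of `D₊(S¹)` on `L₋`
    (∀ f ∈ Lm, IsSharp G Lm ε C 1 f f) ∧
    (∀ k₁ ∈ DPlus, ∀ k₂ ∈ DPlus, InDomain ε k₁ → InDomain ε (k₁ * k₂) →
      ∀ f ∈ Lm, ∀ g, IsSharp G Lm ε C k₂ f g →
        ∀ h, IsSharp G Lm ε C (k₁ * k₂) f h ↔ IsSharp G Lm ε C k₁ g h) ∧
    -- if curves in `L(G)` factor locally, then so do the curves `k_s ⋄ f`
    (FactorsLocally G Lm → ∀ r k, IsDiffeoCurve r k → ∀ f ∈ Lm,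
      ∃ r' g, r' ≤ r ∧ IsCurveIn Lm r' g f ∧
        ∀ s ∈ Ioo (-r') r', IsSharp G Lm ε C (k s) f (g s)) ∧
    -- the infinitesimal action of the vector field `ξ ∂/∂λ` on the circle
    (∀ r k ξ, IsDiffeoCurve r k → HasVelocity k ξ → ∀ f ∈ Lm, ∀ g,
      (∀ s ∈ Ioo (-r) r, IsSharp G Lm ε C (k s) f (g s)) → SmoothCurve r g →
        symbol C ξ f ∈ loopAlg G ∧
        HasLoopVelocity g (fun z => -(minusPart G Lm (symbol C ξ f) z) * (f z : A))) ∧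
    -- `Z_j` is the infinitesimal action of `X_j = λ^{j+1} ∂/∂λ = ξ ∂/∂λ + i η ∂/∂λ`
    (∀ j : ℤ, -1 ≤ j → ∀ r k l ξ η, IsDiffeoCurve r k → HasVelocity k ξ →
      IsDiffeoCurve r l → HasVelocity l η →
      (∀ z : Circle, ξ z + Complex.I * η z = (z : ℂ) ^ (j + 1)) →
      ∀ f ∈ Lm, ∀ g h,
        (∀ s ∈ Ioo (-r) r, IsSharp G Lm ε C (k s) f (g s)) → SmoothCurve r g →
        (∀ s ∈ Ioo (-r) r, IsSharp G Lm ε C (l s) f (h s)) → SmoothCurve r h →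
        ∀ g' h', HasLoopVelocity g g' → HasLoopVelocity h h' →
          ∀ z, virasoroField G Lm C j f z =
            g' z + minusPart G Lm (fun w => Complex.I • (h' w * ((f w)⁻¹ : Aˣ))) z * (f z : A)) ∧
    -- the `Z_j` are vector fields on `L₋` and define an action of the half Virasoro algebra
    (∀ j : ℤ, -1 ≤ j → (∀ f ∈ Lm, virasoroSymbol C j f ∈ loopAlg G) ∧
      IsTangentField Lm (virasoroField G Lm C j)) ∧
    (∀ j k : ℤ, -1 ≤ j → -1 ≤ k →
      IsLieBracket Lm (virasoroField G Lm C j) (virasoroField G Lm C k)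
        (fun f z => ((k - j : ℤ) : ℂ) • virasoroField G Lm C (j + k) f z)) := by
  refine ⟨fun k hk hd f hf => diamond_mem_loopGroup hC hk.1 hd (hL.le hf),
    fun k _ f _ g h hg hh => hg.unique hL hh,
    fun f hf => isSharp_one hC hf,
    fun k₁ hk₁ k₂ _ h₁ h₁₂ f _ g hg h => isSharp_mul_iff hC hk₁ h₁ h₁₂ hg,
    fun hF r k hk f hf => exists_isSharp_curve hL hC hF hk hf,
    fun r k ξ hk hξ f hf g hg hgs => hasLoopVelocity_sharp hG hL hC hk hξ hf hg hgs,
    fun j _ r k l ξ η hk hξ hl hη hj f hf g h hg hgs hh hhs g' h' hg' hh' z =>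
      virasoroField_eq hG hL hC j hk hξ hl hη hj hf hg hgs hh hhs hg' hh' z,
    fun j _ => ⟨fun f hf => virasoroSymbol_mem_loopAlg hG hC j (hL.le hf),
      isTangentField_virasoroField hG hL hC j⟩,
    fun j k hj hk => isLieBracket_virasoroField hG hL hC hj hk⟩
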